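/- Throughout, bits are elements of $\mathbb F_2$, $\bar x=x+1$, $d_S(u,w)$ is the number of positions $i\in S$ with $u[i]\ne w[i]$, and a measurement operator is a positive semidefinite operator. **Source.** A source emits density matrices $\rho_a^g$ ($a,g\in\{0,1\}$) on a finite-dimensional Hilbert space $\mathcal H_Q$. It is *quasiperfect* with parameters $(\beta,\gamma)$ if there are orthogonal projections $P_a^g,\widetilde P_a^g$ such that, for all $a,g$: (1) $P_a^0+P_a^1=\widetilde P_a^0+\widetilde P_a^1=\mathbf 1$; (2) $\rho_0^0+\rho_0^1=\rho_1^0+\rho_1^1=:H$; (3) $\mathrm{Tr}\,P_a^gH=1$; (4) there are unitaries $T_a$ with $T_a^\dagger P_a^gT_a=\widetilde P_a^g$ and $T_a^\dagger HT_a=H$; (5) $\widetilde P_a^0H\widetilde P_a^1=0$; (6) $\widetilde P_a^g\rho_{\bar a}^0\widetilde P_a^g=\widetilde P_a^g\rho_{\bar a}^1\widetilde P_a^g$; (7) there are unitaries $S_a$ such that $S_a^\dagger P_a^gS_a$ and $S_a^\dagger\rho_a^gS_a$ are diagonal; (8) $\mathrm{Tr}\,P_a^g\rho_a^{\bar g}\le\beta$;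 (9) the sum of the absolute values of the eigenvalues (with multiplicity) of $P_a^gH-\widetilde P_a^gH$ is at most $\gamma$. **Parameters and conditions.** Let $m<n$ and $1\le r\le n$ be integers, $\delta_{\mathcal P},\epsilon_N,\epsilon>0$, $N=\lceil(4+\epsilon_N)n\rceil$, and let $F$ and $K$ be binary $r\times n$ and $m\times n$ matrices. Let $\lambda$ satisfy $\frac{\lambda}{1-\lambda}\delta_{\mathcal P}\ge\frac12\epsilon+\beta$. Assume that every linear combination of rows of $F$ and $K$ that contains at least one row of $K$ has weight at least $2(\frac1{1-\lambda}\delta_{\mathcal P}+\frac12\gamma+\epsilon)n$, and that $F$ is the parity check matrix of a linear code that can correct $\lceil(\delta_{\mathcal P}+\epsilon)n\rceil$ errors. **Protocol BB84MM.** Fix the basis string $\widetilde b\in\mathbb F_2^N$ that the box announces to Eve-Bob. Let $a,g\in\mathbb F_2^N$, a permutation $\pi$ of the $N$ positions and a set $R$ of $\lfloor N/2\rfloor$ positions be uniformly random. Put $b[i]=\widetilde b[i]$ for $i\in R$, $b[i]=\overline{\widetilde b[i]}$ for $i\notin R$, and $\Omega=\{i: a[i]=b[i]\}$. Only the outcomes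 with $|\Omega\cap R|\ge n$ and $|\Omega\cap\overline R|\ge n$ are kept; let $C$ be the set of these outcomes $c=(a,g,\pi,R)$, with the uniform distribution. Let $S_{\mathcal P}$ and $S_{\mathcal K}$ be the sets of the first $n$ positions of $\Omega\cap R$ and of $\Omega\cap\overline R$ in the ordering given by $\pi$, and let $s=Fg[S_{\mathcal K}]$. The announcement is $y=(a,g[\overline{S_{\mathcal K}}],R,s,\pi)$. With $\mathcal H_C=\mathrm{span}\{|c\rangle\}_{c\in C}$ and $\mathcal H_S=\mathcal H_Q^{\otimes N}$, the state on $\mathcal H_C\otimes\mathcal H_S$ is $$\rho=\frac1{|C|}\sum_{c\in C}|c\rangle\langle c|\otimes\bigotimes_{i=1}^N\rho_{a[i]}^{g[i]} .$$ **Normalized attack.** This is a POVM $\{F_v\}_{v\in\mathcal V}$ on $\mathcal H_C\otimes\mathcal H_S$ with a finite set $\mathcal V$ of views $v=(y,h,j)$, where $y$ is a possible announcement, $h\in\mathbb F_2^N$, and $j$ is any further information, such that: $P(v):=\mathrm{Tr}\,F_v\rho>0$ for all $v\in\mathcal V$; $P(\mathcal P)>0$, where $\mathcal P\subseteq\mathcal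 V$ is the set of views with $d_{S_{\mathcal P}}(g,h)\le\lfloor\delta_{\mathcal P}n\rfloor$; $F_v=\Pi^C_{y(v)}\otimes E_v$ for some measurement operator $E_v$ on $\mathcal H_S$, where $\Pi^C_y$ projects onto the span of the $|c\rangle$ with announcement $y$; and, for every $h$, the sum of $F_v$ over the views $v\in\mathcal V$ with outcome $h$ equals $\mathbf 1_{\mathcal H_C}\otimes E_h$ for some measurement operator $E_h$ on $\mathcal H_S$. **Small sphere property.** Let $g(n,\epsilon)=e^{-\epsilon^2n}+e^{-\epsilon^2n/2}$. For a view $v$ let $\widetilde\Pi_0(v)$ be the projection $\sum_w\bigotimes_{i=1}^N\widetilde P_{\widetilde b[i]}^{w[i]}$ on $\mathcal H_S$, the sum being over all $w\in\mathbb F_2^N$ with $d_{S_{\mathcal K}}(w,h)\ge(\frac1{1-\lambda}\delta_{\mathcal P}+\frac12\gamma+\epsilon)n$. Put $$\mathcal L_\epsilon=\bigl\{v\in\mathcal P:\ \mathrm{Tr}\bigl[F_v\,\widetilde\Pi_0(v)\,\rho\,\widetilde\Pi_0(v)\bigr]\le\sqrt{g(n,\epsilon)}\,P(v)\bigr\}.$$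 **Proposition.** For every source that is quasiperfect with parameters $(\beta,\gamma)$ (with any choice of projections $P_a^g,\widetilde P_a^g$ as above), all parameters that satisfy the conditions above, every $\widetilde b\in\mathbb F_2^N$ and every normalized attack on BB84MM, $$P(\mathcal L_\epsilon)\ \ge\ P(\mathcal P)-\sqrt{g(n,\epsilon)} .$$ -/

import Mathlib

open scoped Matrix Kronecker ComplexOrder

noncomputable section

namespace BB84

/-! ### Linear algebra -/

/-- The linear map on the `N`-fold tensor power of `ℂ^ι` given by the tensor product
`A 0 ⊗ A 1 ⊗ ⋯ ⊗ A (N - 1)`; the tensor power has the product basis indexed by `Fin N → ι`. -/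
def tensorMatrix {ι : Type*} {N : ℕ} (A : Fin N → Matrix ι ι ℂ) :
    Matrix (Fin N → ι) (Fin N → ι) ℂ :=
  Matrix.of fun x y => ∏ k, A k (x k) (y k)

/-- The sum of the absolute values of the eigenvalues of a matrix, with multiplicity. -/
def sumAbsEigenvalues {ι : Type*} [Fintype ι] [DecidableEq ι] (A : Matrix ι ι ℂ) : ℝ :=
  (A.charpoly.roots.map fun z => ‖z‖).sum

/-- A positive operator valued measure with the finite set of outcomes `V`. -/
structure IsPOVM {X Q : Type*} [Fintype X] [DecidableEq X] (V : Finset Q)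
    (F : Q → Matrix X X ℂ) : Prop where
  posSemidef : ∀ v ∈ V, (F v).PosSemidef
  sum_eq_one : ∑ v ∈ V, F v = 1

/-! ### The source -/

/-- The source emitting `ρ a g` (for the basis-bit `a` and the key-bit `g`) is quasiperfect with
parameters `(β, γ)`, as witnessed by the projections `P a g` and `Pt a g`.
The complement of a bit `x` is `x + 1`. -/
structure IsQuasiperfect {ι : Type*} [Fintype ι] [DecidableEq ι]
    (ρ P Pt : ZMod 2 → ZMod 2 → Matrix ι ι ℂ) (β γ : ℝ) : Prop where
  /-- The emitted states are density matrices. -/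
  density_posSemidef : ∀ a g, (ρ a g).PosSemidef
  density_trace : ∀ a g, (ρ a g).trace = 1
  proj : ∀ a g, IsStarProjection (P a g)
  projT : ∀ a g, IsStarProjection (Pt a g)
  resolution : ∀ a, P a 0 + P a 1 = 1
  resolutionT : ∀ a, Pt a 0 + Pt a 1 = 1
  sum_eq : ρ 0 0 + ρ 0 1 = ρ 1 0 + ρ 1 1
  trace_proj : ∀ a g, (P a g * (ρ 0 0 + ρ 0 1)).trace = 1
  exists_T : ∀ a, ∃ T ∈ Matrix.unitaryGroup ι ℂ,
    (∀ g, Tᴴ * P a g * T = Pt a g) ∧ Tᴴ * (ρ 0 0 + ρ 0 1) * T = ρ 0 0 + ρ 0 1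
  orth : ∀ a, Pt a 0 * (ρ 0 0 + ρ 0 1) * Pt a 1 = 0
  split : ∀ a g, Pt a g * ρ (a + 1) 0 * Pt a g = Pt a g * ρ (a + 1) 1 * Pt a g
  exists_S : ∀ a, ∃ S ∈ Matrix.unitaryGroup ι ℂ,
    ∀ g, (Sᴴ * P a g * S).IsDiag ∧ (Sᴴ * ρ a g * S).IsDiag
  beta_bound : ∀ a g, (P a g * ρ a (g + 1)).trace.re ≤ β
  gamma_bound : ∀ a g,
    sumAbsEigenvalues (P a g * (ρ 0 0 + ρ 0 1) - Pt a g * (ρ 0 0 + ρ 0 1)) ≤ γ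

/-! ### Parameters of the protocol -/

/-- The operating parameters on which Alice and Bob agree. -/
structure Params where
  /-- length of the key -/
  m : ℕ
  /-- number of bits used for the validation test, and for the definition of the key -/
  n : ℕ
  /-- number of rows of the parity check matrix -/
  r : ℕ
  /-- threshold for the error rate of the validation test -/
  δP : ℝ
  /-- determines the number of signals -/
  εN : ℝ
  /-- security parameter -/
  ε : ℝ
  /-- parity check matrix -/
  F : Matrix (Fin r) (Fin n) (ZMod 2)
  /-- privacy amplification matrix -/
  K : Matrix (Fin m) (Fin n) (ZMod 2)
  m_lt_n : m < n
  one_le_r : 1 ≤ r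
  r_le_n : r ≤ n
  δP_pos : 0 < δP
  εN_pos : 0 < εN
  ε_pos : 0 < ε

/-- The number `N_total = ⌈(4 + ε_N) n⌉` of exchanged quantum signals. -/
def Params.N (pr : Params) : ℕ := ⌈(4 + pr.εN) * (pr.n : ℝ)⌉₊

/-- The set of codewords of the code with generator matrix `G` (the span of its rows). -/
def code {k n : ℕ} (G : Matrix (Fin k) (Fin n) (ZMod 2)) : Set (Fin n → ZMod 2) :=
  {w | ∃ v : Fin k → ZMod 2, w = v ᵥ* G}

/-- The minimal weight of the nonzero codewords. -/
def minDistance {k n : ℕ} (G : Matrix (Fin k) (Fin n) (ZMod 2)) : ℕ :=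
  sInf {d | ∃ w ∈ code G, w ≠ 0 ∧ hammingNorm w = d}

/-- `F` is the parity check matrix of a linear `(n, k)` code with `k ≥ 1` that can correct
`t` errors. -/
def IsParityCheckCorrecting {r n : ℕ} (F : Matrix (Fin r) (Fin n) (ZMod 2)) (t : ℕ) : Prop :=
  ∃ (k : ℕ) (G : Matrix (Fin k) (Fin n) (ZMod 2)), 1 ≤ k ∧ k + r = n ∧
    LinearIndependent (ZMod 2) G.row ∧ (∀ w, F *ᵥ w = 0 ↔ w ∈ code G) ∧
    t ≤ (minDistance G - 1) / 2

/-- The conditions on the parameters of a BB84 protocol with a source that is quasiperfect with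
parameters `(β, γ)`. -/
structure Conditions (pr : Params) (β γ lam : ℝ) : Prop where
  lam_cond : lam / (1 - lam) * pr.δP ≥ pr.ε / 2 + β
  /-- Every linear combination of rows of `F` and `K` that contains at least one row of `K`
  has at least the stated weight. -/
  weight_cond : ∀ (u : Fin pr.r → ZMod 2) (x : Fin pr.m → ZMod 2), x ≠ 0 →
    2 * (1 / (1 - lam) * pr.δP + γ / 2 + pr.ε) * pr.n ≤
      (hammingNorm (u ᵥ* pr.F + x ᵥ* pr.K) : ℝ)
  code_cond : IsParityCheckCorrecting pr.F ⌈(pr.δP + pr.ε) * (pr.n : ℝ)⌉₊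

/-! ### The classical part of the modified protocol BB84MM -/

/-- Bob's basis `b`, which the box computes from the announced string `bt` and the set `R`:
it is `bt` on `R` and the complement of `bt` outside of `R`. -/
def basisB {N : ℕ} (bt : Fin N → ZMod 2) (R : Finset (Fin N)) (i : Fin N) : ZMod 2 :=
  if i ∈ R then bt i else bt i + 1

/-- The set of positions on which the bases of Alice and Bob agree. -/
def agree {N : ℕ} (bt a : Fin N → ZMod 2) (R : Finset (Fin N)) : Finset (Fin N) :=
  Finset.univ.filter fun i => a i = basisB bt R i

/-- Alice's basis `a`, the permutation `π` and the set `R` of positions, such that the bases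
agree on at least `n` positions in `R` and on at least `n` positions outside of `R`. -/
@[ext] structure Setting (pr : Params) (bt : Fin pr.N → ZMod 2) where
  a : Fin pr.N → ZMod 2
  π : Equiv.Perm (Fin pr.N)
  R : Finset (Fin pr.N)
  card_R : R.card = pr.N / 2
  enough_in : pr.n ≤ (agree bt a R ∩ R).card
  enough_out : pr.n ≤ (agree bt a R ∩ Rᶜ).card

instance {pr : Params} {bt : Fin pr.N → ZMod 2} : Fintype (Setting pr bt) :=
  Fintype.ofInjective
    (fun τ : Setting pr bt => ((τ.a, τ.π, τ.R) :
      (Fin pr.N → ZMod 2) × Equiv.Perm (Fin pr.N) × Finset (Fin pr.N)))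
    (fun x y h => by
      simp only [Prod.mk.injEq] at h
      exact Setting.ext h.1 h.2.1 h.2.2)

/-- The first `n` positions in `T`, in the ordering which results after applying `π`
(so `i` precedes `j` if `π i < π j`). -/
def firstPositions {N n : ℕ} (π : Equiv.Perm (Fin N)) (T : Finset (Fin N)) (h : n ≤ T.card) :
    Fin n → Fin N :=
  fun k => π.symm ((T.map π.toEmbedding).orderEmbOfFin (Finset.card_map _) (Fin.castLE h k))

variable {pr : Params} {bt : Fin pr.N → ZMod 2}

/-- The positions used for the validation test. -/
def Setting.SP (τ : Setting pr bt) : Finset (Fin pr.N) :=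
  Finset.univ.image (firstPositions τ.π _ τ.enough_in)

/-- The positions used for the definition of the key. -/
def Setting.SK (τ : Setting pr bt) : Finset (Fin pr.N) :=
  Finset.univ.image (firstPositions τ.π _ τ.enough_out)

/-- The classical states `c = (a, g, π, R, s)` that pass the check on the number of positions
where the bases agree; the syndrome `s` is a function of the other variables. -/
abbrev ClassicalState (pr : Params) (bt : Fin pr.N → ZMod 2) : Type :=
  Setting pr bt × (Fin pr.N → ZMod 2)

/-- The syndrome `s = F g[S_K]`. -/
def syndrome (c : ClassicalState pr bt) : Fin pr.r → ZMod 2 :=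
  pr.F *ᵥ fun k => c.2 (firstPositions c.1.π _ c.1.enough_out k)

/-- The classical announcements `y = (a, g[complement of S_K], R, s, π)`. -/
structure Announcement (pr : Params) (bt : Fin pr.N → ZMod 2) where
  τ : Setting pr bt
  g : {i // i ∉ τ.SK} → ZMod 2
  s : Fin pr.r → ZMod 2

/-- The announcement that is made when the classical state is `c`. -/
def announce (c : ClassicalState pr bt) : Announcement pr bt where
  τ := c.1
  g := fun i => c.2 i
  s := syndrome c

/-- The number `d_S(u, w)` of differences between two strings on `S`. -/
def distOn {N : ℕ} (S : Finset (Fin N)) (u w : Fin N → ZMod 2) : ℕ :=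
  (S.filter fun i => u i ≠ w i).card

/-- The complete views `v = (y, h, j)`, where `j` is any additional information. -/
abbrev View (pr : Params) (bt : Fin pr.N → ZMod 2) (J : Type*) :=
  Announcement pr bt × (Fin pr.N → ZMod 2) × J

variable {J : Type*}

/-- The view passes the validation test: the number of differences between `h` and the announced
bits `g` on `S_P` is at most `⌊δ_P n⌋`. (The set `S_P` is disjoint from `S_K`.) -/
def Passes (v : View pr bt J) : Prop :=
  (Finset.univ.filter fun i : {i // i ∉ v.1.τ.SK} =>
    i.1 ∈ v.1.τ.SP ∧ v.1.g i ≠ v.2.1 i.1).card ≤ ⌊pr.δP * (pr.n : ℝ)⌋₊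

/-! ### The quantum part -/

variable {ι : Type*} [Fintype ι] [DecidableEq ι]

open Classical in
/-- The state `∑ c, P(c) |c⟩⟨c| ⊗ ρ_c` on `H_C ⊗ H_S`. Here `P` is the uniform distribution on the
classical states and `ρ_c` is the tensor product of the states emitted by the source. -/
def systemState (pr : Params) (bt : Fin pr.N → ZMod 2) (ρ : ZMod 2 → ZMod 2 → Matrix ι ι ℂ) :
    Matrix (ClassicalState pr bt × (Fin pr.N → ι)) (ClassicalState pr bt × (Fin pr.N → ι)) ℂ :=
  ∑ c : ClassicalState pr bt,
    ((Fintype.card (ClassicalState pr bt) : ℂ)⁻¹) •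
      (Matrix.single c c (1 : ℂ) ⊗ₖ tensorMatrix fun i => ρ (c.1.a i) (c.2 i))

open Classical in
/-- The projection of `H_C` onto the span of the classical states that are compatible with the
announcement `y`. -/
def projC (y : Announcement pr bt) :
    Matrix (ClassicalState pr bt) (ClassicalState pr bt) ℂ :=
  ∑ c ∈ Finset.univ.filter (fun c : ClassicalState pr bt => announce c = y),
    Matrix.single c c (1 : ℂ)

/-- The probability `Tr F_v ρ` of the view `v`. -/
def prob (ρ : ZMod 2 → ZMod 2 → Matrix ι ι ℂ)
    (F : View pr bt J → Matrix (ClassicalState pr bt × (Fin pr.N → ι))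
      (ClassicalState pr bt × (Fin pr.N → ι)) ℂ) (v : View pr bt J) : ℝ :=
  (F v * systemState pr bt ρ).trace.re

open Classical in
/-- The probability of the set of views in `V` that satisfy `A`. -/
def probOf (ρ : ZMod 2 → ZMod 2 → Matrix ι ι ℂ) (V : Finset (View pr bt J))
    (F : View pr bt J → Matrix (ClassicalState pr bt × (Fin pr.N → ι))
      (ClassicalState pr bt × (Fin pr.N → ι)) ℂ) (A : View pr bt J → Prop) : ℝ :=
  ∑ v ∈ V.filter A, prob ρ F v

open Classical in
/-- The family `F`, indexed by the finite set `V` of views, describes a normalized attack on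
BB84MM with the source `ρ`. -/
structure IsNormalizedAttack (ρ : ZMod 2 → ZMod 2 → Matrix ι ι ℂ) (V : Finset (View pr bt J))
    (F : View pr bt J → Matrix (ClassicalState pr bt × (Fin pr.N → ι))
      (ClassicalState pr bt × (Fin pr.N → ι)) ℂ) : Prop where
  povm : IsPOVM V F
  /-- Only announcements that can occur are part of a view. -/
  possible : ∀ v ∈ V, v.1 ∈ Set.range (announce (pr := pr) (bt := bt))
  prob_pos : ∀ v ∈ V, 0 < prob ρ F v
  prob_passes_pos : 0 < probOf ρ V F Passes
  decomp : ∀ v ∈ V, ∃ E : Matrix (Fin pr.N → ι) (Fin pr.N → ι) ℂ,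
    E.PosSemidef ∧ F v = projC v.1 ⊗ₖ E
  /-- The measurement of `h` takes place without any knowledge of the classical outcomes. -/
  decomp_h : ∀ h : Fin pr.N → ZMod 2, ∃ E : Matrix (Fin pr.N → ι) (Fin pr.N → ι) ℂ,
    E.PosSemidef ∧ ∑ v ∈ V.filter (fun v => v.2.1 = h), F v = 1 ⊗ₖ E

/-! ### The small sphere property -/

/-- The function `g(n, ε) = e^{-ε² n} + e^{-ε² n / 2}`. -/
def gBound (n : ℕ) (ε : ℝ) : ℝ :=
  Real.exp (-(ε ^ 2 * n)) + Real.exp (-(ε ^ 2 * n / 2))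

open Classical in
/-- The projection `Π̃₀` of `H_S`: the sum of the projections `⨂ i, Pt (bt i) (w i)` over all
strings `w` whose distance to `h` on `S_K` is at least `(δ_P / (1 - λ) + γ / 2 + ε_L) n`. -/
def proj0 (Pt : ZMod 2 → ZMod 2 → Matrix ι ι ℂ) (γ lam εL : ℝ) (v : View pr bt J) :
    Matrix (Fin pr.N → ι) (Fin pr.N → ι) ℂ :=
  ∑ w ∈ Finset.univ.filter (fun w : Fin pr.N → ZMod 2 =>
      (1 / (1 - lam) * pr.δP + γ / 2 + εL) * pr.n ≤ (distOn v.1.τ.SK w v.2.1 : ℝ)),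
    tensorMatrix fun i => Pt (bt i) (w i)

open Classical in
/-- The view `v` passes the validation test and has the small sphere property
`Tr [F_v Π̃₀ ρ Π̃₀] ≤ √g(n, ε) P(v)`. -/
def SmallSphere (ρ Pt : ZMod 2 → ZMod 2 → Matrix ι ι ℂ) (γ lam εL : ℝ)
    (F : View pr bt J → Matrix (ClassicalState pr bt × (Fin pr.N → ι))
      (ClassicalState pr bt × (Fin pr.N → ι)) ℂ) (v : View pr bt J) : Prop :=
  Passes v ∧
    (F v * (1 ⊗ₖ proj0 Pt γ lam εL v) * systemState pr bt ρ * (1 ⊗ₖ proj0 Pt γ lam εL v)).trace.re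
      ≤ √(gBound pr.n pr.ε) * prob ρ F v

end BB84

end

/-! Write t(v) for Tr[F_v Π̃₀ ρ Π̃₀]. A passing view without the small sphere property has t(v) > √g
P(v), and all t(v) are nonnegative, so by Markov's inequality it is enough that the t(v) of the
passing views sum to at most g(n, ε). This is `sum_passes_le`, a quantum form of the Chernoff bound
for sampling without replacement.

Put s = ε, and let T be the radius in Π̃₀. Passing the test costs a factor exp(sδn) and gains the
weight exp(-s d(g, h)) on the test positions; lying in the range of Π̃₀ gains exp(-sT) against the
weight exp(s d(w, h)) on the key positions. Summing over g leaves H at each key position, whatever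
Alice's basis there, and H has no off-diagonal blocks for P̃. Everything is then dominated by a
product operator (`sum_emitted_le`): `testOp` on test positions, `keyOp` on key positions, H
elsewhere. It depends on the setting only through the two lists of positions. Since h is measured
without classical knowledge, its operators E_h do not depend on the setting and sum to 1.

The settings are symmetric under permutations of positions, so it suffices to average over exchanges
of the k-th test with the k-th key position (`sum_setting_le`). The average factorizes over pairs.
In the ideal case a pair contributes (σ + vσ') ⊗ (τ + uτ') + (σ + uσ') ⊗ (τ + vτ') with u = exp s
and v = 1/u, which is at most (u + v) H ⊗ H because uv = 1 and u + v ≥ 2. This bound no longer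
involves h, so the sum over h collapses to a trace. The defects of the source add operators of trace
at most 2β and γ, giving the factors 1 + β(exp s - 1) and 1 + (γ/2)(exp s - 1) next to cosh s
(`exists_pair_bound`, `sum_swap_le`). Hoeffding's lemma and the condition on λ finish the estimate.
-/

namespace BB84

open scoped MatrixOrder

/-! ### The Loewner order and Schur products -/

section MatrixOrder

variable {α Y κ : Type*}

theorem re_trace_mul_nonneg [Fintype α] {E X : Matrix α α ℂ} (hE : 0 ≤ E) (hX : 0 ≤ X) :
    0 ≤ (E * X).trace.re := by
  classical
  obtain ⟨C, rfl⟩ := CStarAlgebra.nonneg_iff_eq_star_mul_self.mp hE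
  rw [mul_assoc, Matrix.trace_mul_comm]
  have h := (Matrix.nonneg_iff_posSemidef.mp hX).mul_mul_conjTranspose_same C
  exact (Complex.le_def.mp h.trace_nonneg).1

theorem re_trace_mul_le [Fintype α] {E X X' : Matrix α α ℂ} (hE : 0 ≤ E) (hX : X ≤ X') :
    (E * X).trace.re ≤ (E * X').trace.re := by
  have h := re_trace_mul_nonneg hE (sub_nonneg.mpr hX)
  rw [mul_sub, Matrix.trace_sub, Complex.sub_re] at h
  linarith

/-- The entrywise product of the pullbacks of matrices `M k` along maps `f k`. -/
def prodPullback (s : Finset κ) (f : κ → Y → α) (M : κ → Matrix α α ℂ) : Matrix Y Y ℂ :=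
  Matrix.of fun x y => ∏ k ∈ s, M k (f k x) (f k y)

theorem hadamard_nonneg {A B : Matrix Y Y ℂ} (hA : 0 ≤ A) (hB : 0 ≤ B) : 0 ≤ A ⊙ B :=
  Matrix.nonneg_iff_posSemidef.mpr
    ((Matrix.nonneg_iff_posSemidef.mp hA).hadamard (Matrix.nonneg_iff_posSemidef.mp hB))

/-- The difference is (A' - A) ⊙ B + A' ⊙ (B' - B), and both terms are nonnegative by Schur's
product theorem. -/
theorem hadamard_le_hadamard [Fintype Y] {A A' B B' : Matrix Y Y ℂ} (hA : A ≤ A') (hB : B ≤ B')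
    (hA' : 0 ≤ A') (hB0 : 0 ≤ B) : A ⊙ B ≤ A' ⊙ B' := by
  have h1 := hadamard_nonneg (sub_nonneg.mpr hA) hB0
  have h2 := hadamard_nonneg hA' (sub_nonneg.mpr hB)
  rw [← sub_nonneg]
  convert add_nonneg h1 h2 using 1
  ext i j
  simp [Matrix.hadamard]
  ring

theorem submatrix_nonneg {A : Matrix α α ℂ} (hA : 0 ≤ A) (f : Y → α) : 0 ≤ A.submatrix f f :=
  Matrix.nonneg_iff_posSemidef.mpr ((Matrix.nonneg_iff_posSemidef.mp hA).submatrix f)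

theorem prodPullback_insert [DecidableEq κ] {s : Finset κ} {k : κ} (hk : k ∉ s) (f : κ → Y → α)
    (M : κ → Matrix α α ℂ) :
    prodPullback (insert k s) f M = (M k).submatrix (f k) (f k) ⊙ prodPullback s f M := by
  ext x y
  simp [prodPullback, Matrix.hadamard, Finset.prod_insert hk]

theorem prodPullback_nonneg [Fintype Y] (s : Finset κ) (f : κ → Y → α) {M : κ → Matrix α α ℂ}
    (hM : ∀ k ∈ s, 0 ≤ M k) : 0 ≤ prodPullback s f M := by
  classical
  induction s using Finset.induction_on with
  | empty =>
    have : prodPullback ∅ f M = Matrix.vecMulVec (fun _ => 1) (star fun _ => 1) := by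
      ext x y
      simp [prodPullback, Matrix.vecMulVec]
    rw [this, Matrix.nonneg_iff_posSemidef]
    exact Matrix.posSemidef_vecMulVec_self_star _
  | insert k s hk ih =>
    rw [prodPullback_insert hk]
    exact hadamard_nonneg (submatrix_nonneg (hM k (by simp)) _)
      (ih fun j hj => hM j (Finset.mem_insert_of_mem hj))

theorem prodPullback_mono [Fintype α] [Fintype Y] (s : Finset κ) (f : κ → Y → α) {M M' : κ → Matrix α α ℂ}
    (hM : ∀ k ∈ s, 0 ≤ M k) (hMM' : ∀ k ∈ s, M k ≤ M' k) :
    prodPullback s f M ≤ prodPullback s f M' := by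
  classical
  induction s using Finset.induction_on with
  | empty => simp [prodPullback]
  | insert k s hk ih =>
    rw [prodPullback_insert hk, prodPullback_insert hk]
    refine hadamard_le_hadamard ?_ (ih (fun j hj => hM j (Finset.mem_insert_of_mem hj))
      fun j hj => hMM' j (Finset.mem_insert_of_mem hj))
      (submatrix_nonneg ((hM k (by simp)).trans (hMM' k (by simp))) _)
      (prodPullback_nonneg s f fun j hj => hM j (Finset.mem_insert_of_mem hj))
    have h := submatrix_nonneg (sub_nonneg.mpr (hMM' k (by simp))) (f k)
    rw [Matrix.submatrix_sub] at h
    exact sub_nonneg.mp h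

end MatrixOrder

/-! ### Tensor products over all positions -/

section Tensor

variable {ι : Type*} {N : ℕ}

theorem tensorMatrix_nonneg [Fintype ι] {A : Fin N → Matrix ι ι ℂ} (hA : ∀ k, 0 ≤ A k) :
    0 ≤ tensorMatrix A :=
  prodPullback_nonneg _ _ fun k _ => hA k

theorem tensorMatrix_mul [Fintype ι] (A B : Fin N → Matrix ι ι ℂ) :
    tensorMatrix A * tensorMatrix B = tensorMatrix fun k => A k * B k := by
  classical
  ext x y
  simp only [tensorMatrix, Matrix.mul_apply, Matrix.of_apply, Finset.prod_univ_sum,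
    Fintype.piFinset_univ, Finset.prod_mul_distrib]

theorem tensorMatrix_conjTranspose (A : Fin N → Matrix ι ι ℂ) :
    (tensorMatrix A)ᴴ = tensorMatrix fun k => (A k)ᴴ := by
  ext x y
  simp [tensorMatrix, Matrix.conjTranspose_apply]

theorem tensorMatrix_eq_zero {A : Fin N → Matrix ι ι ℂ} {k : Fin N} (hk : A k = 0) :
    tensorMatrix A = 0 := by
  ext x y
  exact Finset.prod_eq_zero (Finset.mem_univ k) (by simp [hk])

theorem tensorMatrix_sum {β : Type*} [DecidableEq β] (t : Fin N → Finset β)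
    (A : Fin N → β → Matrix ι ι ℂ) :
    tensorMatrix (fun k => ∑ b ∈ t k, A k b)
      = ∑ w ∈ Fintype.piFinset t, tensorMatrix fun k => A k (w k) := by
  ext x y
  simp only [tensorMatrix, Matrix.of_apply, Matrix.sum_apply, Finset.prod_univ_sum]

theorem tensorMatrix_smul (c : Fin N → ℂ) (A : Fin N → Matrix ι ι ℂ) :
    tensorMatrix (fun k => c k • A k) = (∏ k, c k) • tensorMatrix A := by
  ext x y
  simp [tensorMatrix, Finset.prod_mul_distrib]

end Tensor

/-! ### Tensor products grouped into pairs of positions -/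

section PairTensor

variable {ι κ : Type*} [Fintype κ] {n N : ℕ}

/-- The tensor product of operators `M k` on pairs of positions and operators `Z j` on the
remaining positions; the positions are enumerated by `e`. -/
def pairTensor (e : (Fin n ⊕ Fin n) ⊕ κ ≃ Fin N) (M : Fin n → Matrix (ι × ι) (ι × ι) ℂ)
    (Z : κ → Matrix ι ι ℂ) : Matrix (Fin N → ι) (Fin N → ι) ℂ :=
  prodPullback Finset.univ (fun k x => (x (e (.inl (.inl k))), x (e (.inl (.inr k))))) M ⊙
    prodPullback Finset.univ (fun j x => x (e (.inr j))) Z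

variable (e : (Fin n ⊕ Fin n) ⊕ κ ≃ Fin N)

theorem tensorMatrix_eq_pairTensor (A : Fin N → Matrix ι ι ℂ) :
    tensorMatrix A = pairTensor e (fun k => A (e (.inl (.inl k))) ⊗ₖ A (e (.inl (.inr k))))
      fun j => A (e (.inr j)) := by
  ext x y
  simp [tensorMatrix, pairTensor, prodPullback, Matrix.hadamard, ← e.prod_comp,
    Fintype.prod_sum_type, Finset.prod_mul_distrib]

theorem sum_pairTensor (M : Bool → Fin n → Matrix (ι × ι) (ι × ι) ℂ) (Z : κ → Matrix ι ι ℂ) :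
    ∑ u : Fin n → Bool, pairTensor e (fun k => M (u k) k) Z
      = pairTensor e (fun k => M true k + M false k) Z := by
  ext x y
  have h := Finset.prod_univ_sum (fun _ : Fin n => (Finset.univ : Finset Bool)) fun k b =>
    M b k (x (e (.inl (.inl k))), x (e (.inl (.inr k)))) (y (e (.inl (.inl k))), y (e (.inl (.inr k))))
  simp only [Fintype.piFinset_univ, Fintype.sum_bool] at h
  simp only [pairTensor, prodPullback, Matrix.hadamard, Matrix.sum_apply, Matrix.of_apply,
    Matrix.add_apply, h, Finset.sum_mul]

theorem pairTensor_mono [Fintype ι] {M M' : Fin n → Matrix (ι × ι) (ι × ι) ℂ}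
    {Z : κ → Matrix ι ι ℂ} (hM : ∀ k, 0 ≤ M k) (hMM' : ∀ k, M k ≤ M' k) (hZ : ∀ j, 0 ≤ Z j) :
    pairTensor e M Z ≤ pairTensor e M' Z :=
  hadamard_le_hadamard (prodPullback_mono _ _ (fun k _ => hM k) fun k _ => hMM' k) le_rfl
    (prodPullback_nonneg _ _ fun k _ => (hM k).trans (hMM' k))
    (prodPullback_nonneg _ _ fun j _ => hZ j)

theorem trace_pairTensor [Fintype ι] (M : Fin n → Matrix (ι × ι) (ι × ι) ℂ)
    (Z : κ → Matrix ι ι ℂ) :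
    (pairTensor e M Z).trace = (∏ k, (M k).trace) * ∏ j, (Z j).trace := by
  classical
  -- Splits a basis index into its coordinates at the pairs and at the remaining positions, so that
  -- the trace becomes a product of sums.
  let φ : (Fin N → ι) ≃ (Fin n → ι × ι) × (κ → ι) :=
    (e.symm.arrowCongr (Equiv.refl ι)).trans ((Equiv.sumArrowEquivProdArrow _ _ _).trans
      (((Equiv.sumArrowEquivProdArrow _ _ _).trans (Equiv.arrowProdEquivProdArrow _ _ _).symm).prodCongr
        (Equiv.refl _)))
  have h1 : ∀ x : Fin N → ι, pairTensor e M Z x x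
      = (∏ k, M k ((φ x).1 k) ((φ x).1 k)) * ∏ j, Z j ((φ x).2 j) ((φ x).2 j) := fun x => rfl
  simp only [Matrix.trace, Matrix.diag_apply, h1]
  rw [φ.sum_comp fun z => (∏ k, M k (z.1 k) (z.1 k)) * ∏ j, Z j (z.2 j) (z.2 j),
    Fintype.sum_prod_type, Finset.prod_univ_sum, Finset.prod_univ_sum, Finset.sum_mul_sum]
  simp only [Fintype.piFinset_univ]

end PairTensor

/-! ### Kronecker products and the absolute value -/

section Kronecker

variable {ι ι' : Type*} [Fintype ι] [Fintype ι']

theorem ofReal_smul_nonneg {α : Type*} {r : ℝ} (hr : 0 ≤ r) {M : Matrix α α ℂ} (hM : 0 ≤ M) :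
    0 ≤ (r : ℂ) • M :=
  Matrix.nonneg_iff_posSemidef.mpr
    ((Matrix.nonneg_iff_posSemidef.mp hM).smul (Complex.zero_le_real.mpr hr))

theorem kronecker_nonneg {A : Matrix ι ι ℂ} {B : Matrix ι' ι' ℂ} (hA : 0 ≤ A) (hB : 0 ≤ B) :
    0 ≤ A ⊗ₖ B :=
  Matrix.nonneg_iff_posSemidef.mpr
    ((Matrix.nonneg_iff_posSemidef.mp hA).kronecker (Matrix.nonneg_iff_posSemidef.mp hB))

theorem kronecker_le_kronecker {A A' : Matrix ι ι ℂ} {B B' : Matrix ι' ι' ℂ} (hA : A ≤ A')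
    (hB : B ≤ B') (hA' : 0 ≤ A') (hB0 : 0 ≤ B) : A ⊗ₖ B ≤ A' ⊗ₖ B' := by
  rw [← sub_nonneg]
  convert add_nonneg (kronecker_nonneg (sub_nonneg.mpr hA) hB0)
    (kronecker_nonneg hA' (sub_nonneg.mpr hB)) using 1
  ext i j
  simp [Matrix.kroneckerMap_apply]
  ring

/-- The absolute value of a Hermitian matrix. -/
theorem exists_abs [DecidableEq ι] {A : Matrix ι ι ℂ} (hA : A.IsHermitian) :
    ∃ B : Matrix ι ι ℂ, 0 ≤ B ∧ A ≤ B ∧ -A ≤ B ∧ B.trace = (sumAbsEigenvalues A : ℂ) := by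
  set U : Matrix ι ι ℂ := (hA.eigenvectorUnitary : Matrix ι ι ℂ)
  have hUU : Uᴴ * U = 1 := Matrix.mem_unitaryGroup_iff'.mp hA.eigenvectorUnitary.2
  have hdiag : ∀ d : ι → ℝ, (∀ i, 0 ≤ d i) →
      0 ≤ U * Matrix.diagonal (fun i => (d i : ℂ)) * Uᴴ := fun d hd =>
    Matrix.nonneg_iff_posSemidef.mpr ((Matrix.PosSemidef.diagonal
      (fun i => Complex.zero_le_real.mpr (hd i))).mul_mul_conjTranspose_same U)
  have hAU : A = U * Matrix.diagonal (fun i => (hA.eigenvalues i : ℂ)) * Uᴴ := by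
    conv_lhs => rw [hA.spectral_theorem]
    rfl
  refine ⟨U * Matrix.diagonal (fun i => ((|hA.eigenvalues i| : ℝ) : ℂ)) * Uᴴ,
    hdiag _ fun i => abs_nonneg _, ?_, ?_, ?_⟩
  · rw [← sub_nonneg]
    convert hdiag (fun i => |hA.eigenvalues i| - hA.eigenvalues i)
      (fun i => sub_nonneg.mpr (le_abs_self _)) using 1
    refine (congrArg (fun X => _ - X) hAU).trans ?_
    simp only [Complex.ofReal_sub, ← Matrix.diagonal_sub, mul_sub, sub_mul]
  · rw [← sub_nonneg, sub_neg_eq_add]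
    convert hdiag (fun i => |hA.eigenvalues i| + hA.eigenvalues i)
      (fun i => by linarith [neg_abs_le (hA.eigenvalues i)]) using 1
    refine (congrArg (fun X => _ + X) hAU).trans ?_
    simp only [Complex.ofReal_add, ← Matrix.diagonal_add, mul_add, add_mul]
  · rw [Matrix.trace_mul_comm, ← mul_assoc, hUU, one_mul, Matrix.trace_diagonal,
      sumAbsEigenvalues, hA.roots_charpoly_eq_eigenvalues]
    simp [Multiset.map_map]

end Kronecker

theorem zmod_two_cases (h : ZMod 2) : h = 0 ∨ h = 1 := by
  revert h; decide

theorem zmod_two_eq_add_one {x y : ZMod 2} (h : x ≠ y) : x = y + 1 := by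
  revert x y; decide

/-! ### Operator inequalities for a quasiperfect source -/

namespace IsQuasiperfect

variable {ι : Type*} [Fintype ι] [DecidableEq ι] {ρ P Pt : ZMod 2 → ZMod 2 → Matrix ι ι ℂ}
  {β γ : ℝ}

/-- The sum `H` of the two states of a basis. -/
noncomputable def total (ρ : ZMod 2 → ZMod 2 → Matrix ι ι ℂ) : Matrix ι ι ℂ := ρ 0 0 + ρ 0 1

variable (hs : IsQuasiperfect ρ P Pt β γ)
include hs

theorem nonneg (a g : ZMod 2) : 0 ≤ ρ a g :=
  Matrix.nonneg_iff_posSemidef.mpr (hs.density_posSemidef a g)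

theorem add_eq_total (a h : ZMod 2) : ρ a h + ρ a (h + 1) = total ρ := by
  have h11 : (1 : ZMod 2) + 1 = 0 := rfl
  obtain rfl | rfl := zmod_two_cases a <;> obtain rfl | rfl := zmod_two_cases h <;>
    simp [total, h11, add_comm, hs.sum_eq]

theorem sum_eq_total (a : ZMod 2) : ∑ g, ρ a g = total ρ := by
  rw [← hs.add_eq_total a 0]
  exact Fin.sum_univ_two _

theorem proj_add (a h : ZMod 2) : P a h + P a (h + 1) = 1 := by
  have h11 : (1 : ZMod 2) + 1 = 0 := rfl
  obtain rfl | rfl := zmod_two_cases h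
  · simpa using hs.resolution a
  · simpa [h11, add_comm] using hs.resolution a

theorem projT_add (a h : ZMod 2) : Pt a h + Pt a (h + 1) = 1 := by
  have h11 : (1 : ZMod 2) + 1 = 0 := rfl
  obtain rfl | rfl := zmod_two_cases h
  · simpa using hs.resolutionT a
  · simpa [h11, add_comm] using hs.resolutionT a

theorem projT_conjTranspose (a h : ZMod 2) : (Pt a h)ᴴ = Pt a h := (hs.projT a h).isSelfAdjoint

theorem total_nonneg : 0 ≤ total ρ := add_nonneg (hs.nonneg 0 0) (hs.nonneg 0 1)

theorem total_conjTranspose : (total ρ)ᴴ = total ρ :=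
  (Matrix.nonneg_iff_posSemidef.mp hs.total_nonneg).isHermitian

theorem trace_total : (total ρ).trace = 2 := by
  rw [total, Matrix.trace_add, hs.density_trace, hs.density_trace]
  norm_num

/-- Both matrices are diagonal in the basis given by `S`, so they commute; hence the products `P a g
* ρ a g'` are positive. -/
theorem proj_mul_comm (a g g' : ZMod 2) : P a g * ρ a g' = ρ a g' * P a g := by
  obtain ⟨S, hS, hd⟩ := hs.exists_S a
  have h1 : Sᴴ * S = 1 := Matrix.mem_unitaryGroup_iff'.mp hS
  have h2 : S * Sᴴ = 1 := Matrix.mem_unitaryGroup_iff.mp hS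
  have hc : (Sᴴ * P a g * S) * (Sᴴ * ρ a g' * S) = (Sᴴ * ρ a g' * S) * (Sᴴ * P a g * S) := by
    rw [← (hd g).1.diagonal_diag, ← (hd g').2.diagonal_diag, Matrix.diagonal_mul_diagonal,
      Matrix.diagonal_mul_diagonal]
    simp only [mul_comm]
  have key : ∀ X Y : Matrix ι ι ℂ, S * ((Sᴴ * X * S) * (Sᴴ * Y * S)) * Sᴴ = X * Y := by
    intro X Y
    calc S * ((Sᴴ * X * S) * (Sᴴ * Y * S)) * Sᴴ
        = (S * Sᴴ) * X * (S * Sᴴ) * Y * (S * Sᴴ) := by simp only [mul_assoc]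
      _ = X * Y := by simp [h2]
  rw [← key (P a g) (ρ a g'), hc, key]

theorem proj_mul_nonneg (a g g' : ZMod 2) : 0 ≤ P a g * ρ a g' := by
  have h := (hs.density_posSemidef a g').mul_mul_conjTranspose_same (P a g)
  have hp : (P a g)ᴴ = P a g := (hs.proj a g).isSelfAdjoint
  rw [hp, hs.proj_mul_comm, mul_assoc, (hs.proj a g).isIdempotentElem.eq, ← hs.proj_mul_comm] at h
  exact Matrix.nonneg_iff_posSemidef.mpr h

theorem projT_orth (a h : ZMod 2) : Pt a h * total ρ * Pt a (h + 1) = 0 := by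
  have h11 : (1 : ZMod 2) + 1 = 0 := rfl
  have h0 : Pt a 0 * total ρ * Pt a 1 = 0 := hs.orth a
  obtain rfl | rfl := zmod_two_cases h
  · simpa using h0
  · have := congrArg Matrix.conjTranspose h0
    simpa [Matrix.conjTranspose_mul, hs.projT_conjTranspose, hs.total_conjTranspose, h11,
      mul_assoc] using this

/-- With no off-diagonal block, compressing `H` on both sides is the same as on one side. -/
theorem projT_sandwich (a h : ZMod 2) : Pt a h * total ρ * Pt a h = Pt a h * total ρ := by
  conv_rhs => rw [← mul_one (Pt a h * total ρ), ← hs.projT_add a h, mul_add, hs.projT_orth,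
    add_zero]

theorem projT_sandwich_nonneg (a h : ZMod 2) : 0 ≤ Pt a h * total ρ * Pt a h := by
  have := (Matrix.nonneg_iff_posSemidef.mp hs.total_nonneg).mul_mul_conjTranspose_same (Pt a h)
  rw [hs.projT_conjTranspose] at this
  exact Matrix.nonneg_iff_posSemidef.mpr this

/-- The operator `G` which bounds the difference between the emitted states and the
projections of `H`. -/
theorem exists_bound_state : ∃ G : ZMod 2 → Matrix ι ι ℂ, ∀ a, 0 ≤ G a ∧
    (∃ t : ℝ, (G a).trace = t ∧ t ≤ 2 * β) ∧
    ∀ v : ℝ, v ≤ 1 → ∀ h, ρ a h + (v : ℂ) • ρ a (h + 1) ≤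
      P a h * total ρ + (v : ℂ) • (P a (h + 1) * total ρ) + ((1 - v : ℝ) : ℂ) • G a := by
  refine ⟨fun a => P a 0 * ρ a 1 + P a 1 * ρ a 0, fun a => ?_⟩
  have h11 : (1 : ZMod 2) + 1 = 0 := rfl
  have hG : 0 ≤ P a 0 * ρ a 1 + P a 1 * ρ a 0 :=
    add_nonneg (hs.proj_mul_nonneg a 0 1) (hs.proj_mul_nonneg a 1 0)
  refine ⟨hG, ⟨(P a 0 * ρ a 1 + P a 1 * ρ a 0).trace.re, ?_, ?_⟩, fun v hv h => ?_⟩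
  · exact (Complex.eq_re_of_ofReal_le
      (Matrix.nonneg_iff_posSemidef.mp hG).trace_nonneg)
  · have h0 := hs.beta_bound a 0
    have h1 := hs.beta_bound a 1
    rw [h11] at h1
    rw [zero_add] at h0
    rw [Matrix.trace_add, Complex.add_re]
    linarith
  · have hGh : P a 0 * ρ a 1 + P a 1 * ρ a 0 = P a h * ρ a (h + 1) + P a (h + 1) * ρ a h := by
      obtain rfl | rfl := zmod_two_cases h
      · simp
      · rw [h11, add_comm]
    have hP : P a (h + 1) = 1 - P a h := by rw [← hs.proj_add a h]; abel
    beta_reduce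
    rw [hGh, ← sub_nonneg, ← hs.add_eq_total a h]
    -- Before `G` is added, the difference is (1 - v)(P_h ρ_{h+1} - P_{h+1} ρ_h); adding (1 - v)G
    -- cancels the negative term and doubles the other.
    convert ofReal_smul_nonneg (r := 2 * (1 - v)) (by linarith)
      (hs.proj_mul_nonneg a h (h + 1)) using 1
    rw [hP]
    simp only [mul_add, sub_mul, one_mul, smul_add, smul_sub, Complex.ofReal_sub,
      Complex.ofReal_mul, Complex.ofReal_one, Complex.ofReal_ofNat]
    module

/-- The absolute value of the difference between the two decompositions of `H`. -/
theorem exists_bound_proj : ∃ D : ZMod 2 → Matrix ι ι ℂ, ∀ a, 0 ≤ D a ∧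
    (∃ t : ℝ, (D a).trace = t ∧ t ≤ γ) ∧
    ∀ u : ℝ, 1 ≤ u → ∀ h,
      Pt a h * total ρ * Pt a h + (u : ℂ) • (Pt a (h + 1) * total ρ * Pt a (h + 1)) ≤
      P a h * total ρ + (u : ℂ) • (P a (h + 1) * total ρ) + ((u - 1 : ℝ) : ℂ) • D a := by
  have hex : ∀ a, ∃ B : Matrix ι ι ℂ, 0 ≤ B ∧ P a 0 * total ρ - Pt a 0 * total ρ ≤ B ∧
      -(P a 0 * total ρ - Pt a 0 * total ρ) ≤ B ∧
      B.trace = (sumAbsEigenvalues (P a 0 * total ρ - Pt a 0 * total ρ) : ℂ) := by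
    intro a
    refine exists_abs (Matrix.IsHermitian.sub ?_ ?_)
    · have : 0 ≤ P a 0 * total ρ := by
        rw [← hs.add_eq_total a 0, mul_add]
        exact add_nonneg (hs.proj_mul_nonneg _ _ _) (hs.proj_mul_nonneg _ _ _)
      exact (Matrix.nonneg_iff_posSemidef.mp this).isHermitian
    · rw [← hs.projT_sandwich]
      exact (Matrix.nonneg_iff_posSemidef.mp (hs.projT_sandwich_nonneg a 0)).isHermitian
  choose D hD0 hD1 hD2 hDt using hex
  refine ⟨D, fun a => ⟨hD0 a, ⟨_, hDt a, hs.gamma_bound a 0⟩, fun u hu h => ?_⟩⟩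
  have hP : P a (h + 1) = 1 - P a h := by rw [← hs.proj_add a h]; abel
  have hPt : Pt a (h + 1) = 1 - Pt a h := by rw [← hs.projT_add a h]; abel
  -- The differences for the two key bits are negatives of each other, so the same absolute value `D
  -- a` dominates both.
  have hDh : 0 ≤ D a - (P a h * total ρ - Pt a h * total ρ) := by
    obtain rfl | rfl := zmod_two_cases h
    · exact sub_nonneg.mpr (hD1 a)
    · have e1 : P a 1 = 1 - P a 0 := by rw [← hs.resolution a]; abel
      have e2 : Pt a 1 = 1 - Pt a 0 := by rw [← hs.resolutionT a]; abel
      rw [e1, e2, sub_nonneg]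
      convert hD2 a using 1
      simp only [sub_mul, one_mul]
      abel
  rw [← sub_nonneg]
  convert ofReal_smul_nonneg (sub_nonneg.mpr hu) hDh using 1
  rw [hs.projT_sandwich, hs.projT_sandwich, hP, hPt]
  simp only [sub_mul, one_mul, smul_sub, Complex.ofReal_sub, Complex.ofReal_one]
  module

end IsQuasiperfect

/-! ### A test position and a key position, averaged over their exchange -/

section Pair

variable {ι : Type*} [Fintype ι]

/-- The operator on a position of the validation test, weighted by `exp (-s)` for an error. -/
noncomputable def testOp (ρ : ZMod 2 → ZMod 2 → Matrix ι ι ℂ) (s : ℝ) (a h : ZMod 2) : Matrix ι ι ℂ :=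
  ρ a h + ((Real.exp (-s) : ℝ) : ℂ) • ρ a (h + 1)

/-- The operator on a position of the key, weighted by `exp s` for an error. -/
noncomputable def keyOp (ρ Pt : ZMod 2 → ZMod 2 → Matrix ι ι ℂ) (s : ℝ) (a h : ZMod 2) : Matrix ι ι ℂ :=
  Pt a h * IsQuasiperfect.total ρ * Pt a h +
    ((Real.exp s : ℝ) : ℂ) • (Pt a (h + 1) * IsQuasiperfect.total ρ * Pt a (h + 1))

/-- A bound for a swapped pair of operators which does not depend on how `H` splits. -/
theorem kronecker_swap_le {u v : ℝ} (huv : u * v = 1) (hu : 1 ≤ u) {H H' σ σ' τ τ' G G' D D' : Matrix ι ι ℂ}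
    (hσ : σ + σ' = H) (hτ : τ + τ' = H') (hσ0 : 0 ≤ σ) (hσ0' : 0 ≤ σ') (hτ0 : 0 ≤ τ)
    (hτ0' : 0 ≤ τ') (hG : 0 ≤ G) (hG' : 0 ≤ G') (hD : 0 ≤ D) (hD' : 0 ≤ D') :
    (σ + (v : ℂ) • σ' + ((1 - v : ℝ) : ℂ) • G) ⊗ₖ (τ + (u : ℂ) • τ' + ((u - 1 : ℝ) : ℂ) • D') +
      (σ + (u : ℂ) • σ' + ((u - 1 : ℝ) : ℂ) • D) ⊗ₖ (τ + (v : ℂ) • τ' + ((1 - v : ℝ) : ℂ) • G') ≤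
    ((u + v : ℝ) : ℂ) • H ⊗ₖ H' + ((u - 1 : ℝ) : ℂ) • (H ⊗ₖ D' + D ⊗ₖ H' + (G ⊗ₖ H' + H ⊗ₖ G')) +
      ((u + v - 2 : ℝ) : ℂ) • (G ⊗ₖ D' + D ⊗ₖ G') := by
  have hc : 0 ≤ u + v - 2 := by nlinarith [sq_nonneg (u - v), sq_nonneg (u + v)]
  rw [← sub_nonneg]
  -- Since uv = 1, we have v(u - 1) = 1 - v and (1 - v)(u - 1) = u + v - 2; the gap is therefore (u
  -- + v - 2) times a sum of six positive products.
  convert ofReal_smul_nonneg hc (add_nonneg (add_nonneg (add_nonneg (kronecker_nonneg hσ0 hτ0)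
    (kronecker_nonneg hσ0' hτ0')) (add_nonneg (kronecker_nonneg hσ0' hD') (kronecker_nonneg hD hτ0')))
    (add_nonneg (kronecker_nonneg hG hτ0) (kronecker_nonneg hσ0 hG'))) using 1
  have huv' : (u : ℂ) * v = 1 := by exact_mod_cast huv
  subst hσ hτ
  ext ⟨i, i'⟩ ⟨j, j'⟩
  simp only [Matrix.add_apply, Matrix.sub_apply, Matrix.smul_apply, Matrix.kroneckerMap_apply,
    smul_eq_mul, Complex.ofReal_sub, Complex.ofReal_add, Complex.ofReal_one, Complex.ofReal_ofNat]
  linear_combination (-2 * σ' i j * τ' i' j' - σ' i j * D' i' j' + G i j * τ' i' j' +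
    G i j * D' i' j' + σ' i j * G' i' j' - D i j * τ' i' j' + D i j * G' i' j') * huv'

/-- Used with x = β and y = γ/2. As u + v - 2 = v(u - 1)² ≤ (u - 1)², the terms fit into 8(1 + xb)(1
+ yb) with b = u - 1, once the terms in b have been multiplied by cosh s ≥ 1. -/
theorem pair_trace_le {s x y g g' d d' : ℝ} (hs : 0 ≤ s) (hg : g ≤ 2 * x) (hg' : g' ≤ 2 * x)
    (hd : d ≤ 2 * y) (hd' : d' ≤ 2 * y) (hg0 : 0 ≤ g) (hg0' : 0 ≤ g') (hd0 : 0 ≤ d)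
    (hd0' : 0 ≤ d') :
    (Real.exp s + Real.exp (-s)) * (2 * 2) +
      (Real.exp s - 1) * (2 * d' + d * 2 + (g * 2 + 2 * g')) +
      (Real.exp s + Real.exp (-s) - 2) * (g * d' + d * g') ≤
    8 * (Real.cosh s * ((1 + x * (Real.exp s - 1)) * (1 + y * (Real.exp s - 1)))) := by
  have hx : 0 ≤ x := by linarith
  have hy : 0 ≤ y := by linarith
  have hC : 1 ≤ Real.cosh s := Real.one_le_cosh s
  have hu : 1 ≤ Real.exp s := Real.one_le_exp hs
  have huv : Real.exp s * Real.exp (-s) = 1 := by rw [← Real.exp_add]; simp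
  have hsum : Real.exp s + Real.exp (-s) = 2 * Real.cosh s := by rw [Real.cosh_eq]; ring
  have hv0 : 0 < Real.exp (-s) := Real.exp_pos _
  have hc : Real.exp s + Real.exp (-s) - 2 ≤ (Real.exp s - 1) ^ 2 := by
    nlinarith [mul_nonneg (sub_nonneg.mpr hu) (sub_nonneg.mpr hu)]
  have hc0 : 0 ≤ Real.exp s + Real.exp (-s) - 2 := by linarith
  have h1 : g * d' ≤ 2 * x * (2 * y) := mul_le_mul hg hd' hd0' (by linarith)
  have h2 : d * g' ≤ 2 * y * (2 * x) := mul_le_mul hd hg' hg0' (by linarith)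
  set b := Real.exp s - 1 with hb
  have hb0 : 0 ≤ b := by linarith
  calc _ ≤ 8 * Real.cosh s + b * (8 * x + 8 * y) + b ^ 2 * (8 * x * y) := by
        have h3 : b * (2 * d' + d * 2 + (g * 2 + 2 * g')) ≤ b * (8 * x + 8 * y) :=
          mul_le_mul_of_nonneg_left (by linarith) hb0
        have h4 := mul_le_mul hc (show g * d' + d * g' ≤ 8 * x * y by linarith)
          (by positivity) (by positivity)
        linarith
    _ ≤ Real.cosh s * (8 + b * (8 * x + 8 * y) + b ^ 2 * (8 * x * y)) := by
        have h5 : 0 ≤ b * (8 * x + 8 * y) + b ^ 2 * (8 * x * y) := by positivity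
        nlinarith [mul_nonneg (sub_nonneg.mpr hC) h5]
    _ = _ := by ring

/-- The point is that `K` depends on the bases only, not on the outcomes `h`, `h'`: the right side
of `kronecker_swap_le` contains only `H`, `G` and `D`. -/
theorem exists_pair_bound [DecidableEq ι] {ρ P Pt : ZMod 2 → ZMod 2 → Matrix ι ι ℂ} {β γ s : ℝ}
    (hs : IsQuasiperfect ρ P Pt β γ) (hs0 : 0 ≤ s) :
    ∃ (K : ZMod 2 → ZMod 2 → Matrix (ι × ι) (ι × ι) ℂ) (t : ZMod 2 → ZMod 2 → ℝ),
      (∀ a a' h h', testOp ρ s a h ⊗ₖ keyOp ρ Pt s a' h' + keyOp ρ Pt s a h ⊗ₖ testOp ρ s a' h' ≤ K a a') ∧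
      ∀ a a', (K a a').trace = t a a' ∧ t a a' ≤ 8 * (Real.cosh s *
        ((1 + β * (Real.exp s - 1)) * (1 + γ / 2 * (Real.exp s - 1)))) := by
  obtain ⟨G, hG⟩ := hs.exists_bound_state
  obtain ⟨D, hD⟩ := hs.exists_bound_proj
  choose hG0 hGt hGle using hG
  choose hD0 hDt hDle using hD
  choose g hg hgle using hGt
  choose d hd hdle using hDt
  have hu : 1 ≤ Real.exp s := Real.one_le_exp hs0
  have hv : Real.exp (-s) ≤ 1 := Real.exp_le_one_iff.mpr (by linarith)
  have huv : Real.exp s * Real.exp (-s) = 1 := by rw [← Real.exp_add]; simp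
  have hg0 : ∀ a, 0 ≤ g a := fun a => by
    have := (Matrix.nonneg_iff_posSemidef.mp (hG0 a)).trace_nonneg
    rwa [hg, Complex.zero_le_real] at this
  have hd0 : ∀ a, 0 ≤ d a := fun a => by
    have := (Matrix.nonneg_iff_posSemidef.mp (hD0 a)).trace_nonneg
    rwa [hd, Complex.zero_le_real] at this
  have htest0 : ∀ a h, 0 ≤ testOp ρ s a h := fun a h =>
    add_nonneg (hs.nonneg _ _) (ofReal_smul_nonneg (Real.exp_pos _).le (hs.nonneg _ _))
  have hkey0 : ∀ a h, 0 ≤ keyOp ρ Pt s a h := fun a h =>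
    add_nonneg (hs.projT_sandwich_nonneg _ _)
      (ofReal_smul_nonneg (Real.exp_pos _).le (hs.projT_sandwich_nonneg _ _))
  have hσ0 : ∀ a h, 0 ≤ P a h * IsQuasiperfect.total ρ := fun a h => by
    rw [← hs.add_eq_total a h, mul_add]
    exact add_nonneg (hs.proj_mul_nonneg _ _ _) (hs.proj_mul_nonneg _ _ _)
  have hσ : ∀ a h, P a h * IsQuasiperfect.total ρ + P a (h + 1) * IsQuasiperfect.total ρ
      = IsQuasiperfect.total ρ := fun a h => by rw [← add_mul, hs.proj_add, one_mul]
  refine ⟨_, fun a a' => _, fun a a' h h' => le_trans (add_le_add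
    (kronecker_le_kronecker (hGle a _ hv h) (hDle a' _ hu h') ((htest0 a h).trans (hGle a _ hv h))
      (hkey0 a' h'))
    (kronecker_le_kronecker (hDle a _ hu h) (hGle a' _ hv h') ((hkey0 a h).trans (hDle a _ hu h))
      (htest0 a' h')))
    (kronecker_swap_le huv hu (hσ a h) (hσ a' h') (hσ0 _ _) (hσ0 _ _) (hσ0 _ _) (hσ0 _ _)
      (hG0 a) (hG0 a') (hD0 a) (hD0 a')), fun a a' => ⟨?_, pair_trace_le hs0 (hgle a) (hgle a') 
      (by linarith [hdle a]) (by linarith [hdle a']) (hg0 a) (hg0 a') (hd0 a) (hd0 a')⟩⟩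
  simp only [Matrix.trace_add, Matrix.trace_smul, Matrix.trace_kronecker, hs.trace_total, hg, hd,
    smul_eq_mul]
  push_cast
  ring

end Pair

/-! ### Permutation symmetry of the settings -/

section Sampling

variable {pr : Params} {bt : Fin pr.N → ZMod 2}

/-- Any set can be prescribed as the set of agreement by a choice of `a`; this allows settings to be
permuted although `bt` stays fixed. -/
theorem agree_basisB {N : ℕ} (bt : Fin N → ZMod 2) (R T : Finset (Fin N)) :
    agree bt (fun i => if i ∈ T then basisB bt R i else basisB bt R i + 1) R = T := by
  ext i
  by_cases hi : i ∈ T <;> simp [agree, hi]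

/-- Permutations of the positions act on the settings. -/
noncomputable def Setting.act (θ : Equiv.Perm (Fin pr.N)) (τ : Setting pr bt) : Setting pr bt where
  -- The announced string does not move with the positions, so `a` is rebuilt from the transported
  -- set of agreement rather than permuted.
  a i := if i ∈ (agree bt τ.a τ.R).map θ.toEmbedding then basisB bt (τ.R.map θ.toEmbedding) i
    else basisB bt (τ.R.map θ.toEmbedding) i + 1
  π := θ.symm.trans τ.π
  R := τ.R.map θ.toEmbedding
  card_R := by rw [Finset.card_map, τ.card_R]
  enough_in := by
    rw [agree_basisB, ← Finset.map_inter, Finset.card_map]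
    exact τ.enough_in
  enough_out := by
    have h : (τ.R.map θ.toEmbedding)ᶜ = τ.Rᶜ.map θ.toEmbedding := by
      ext i
      simp [Finset.mem_map_equiv]
    rw [agree_basisB, h, ← Finset.map_inter, Finset.card_map]
    exact τ.enough_out

theorem Setting.agree_act (θ : Equiv.Perm (Fin pr.N)) (τ : Setting pr bt) :
    agree bt (τ.act θ).a (τ.act θ).R = (agree bt τ.a τ.R).map θ.toEmbedding :=
  agree_basisB _ _ _

/-- A bit that differs from `basisB` is its complement, so `R` and the set of agreement determine
`a`. -/
theorem Setting.act_injective (θ : Equiv.Perm (Fin pr.N)) :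
    Function.Injective (Setting.act (bt := bt) θ) := by
  intro τ τ' h
  have hR : τ.R = τ'.R := Finset.map_injective _ (congrArg Setting.R h)
  have hΩ : agree bt τ.a τ.R = agree bt τ'.a τ'.R := by
    apply Finset.map_injective θ.toEmbedding
    rw [← agree_act, ← agree_act, h]
  refine Setting.ext (funext fun i => ?_) ?_ hR
  · have hi := Finset.ext_iff.mp hΩ i
    simp only [agree, hR, Finset.mem_filter, Finset.mem_univ, true_and] at hi
    by_cases h1 : τ.a i = basisB bt τ'.R i
    · rw [h1, hi.mp h1]
    · rw [zmod_two_eq_add_one h1, zmod_two_eq_add_one (mt hi.mpr h1)]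
  · have hπ : θ.symm.trans τ.π = θ.symm.trans τ'.π := congrArg Setting.π h
    ext i
    have := congrArg (fun e : Equiv.Perm (Fin pr.N) => e (θ i)) hπ
    simpa using congrArg Fin.val this

/-- The list of the positions used for the validation test. -/
noncomputable def Setting.testPos (τ : Setting pr bt) : Fin pr.n → Fin pr.N :=
  firstPositions τ.π _ τ.enough_in

/-- The list of the positions used for the key. -/
noncomputable def Setting.keyPos (τ : Setting pr bt) : Fin pr.n → Fin pr.N :=
  firstPositions τ.π _ τ.enough_out

theorem firstPositions_injective {N n : ℕ} (π : Equiv.Perm (Fin N)) (T : Finset (Fin N))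
    (h : n ≤ T.card) : Function.Injective (firstPositions π T h) := by
  intro k l hkl
  simpa [firstPositions] using hkl

theorem firstPositions_mem {N n : ℕ} (π : Equiv.Perm (Fin N)) (T : Finset (Fin N))
    (h : n ≤ T.card) (k : Fin n) : firstPositions π T h k ∈ T := by
  have := Finset.orderEmbOfFin_mem (T.map π.toEmbedding) (Finset.card_map _) (Fin.castLE h k)
  rwa [Finset.mem_map_equiv] at this

/-- Moving a set by `θ` and replacing the ordering by π ∘ θ⁻¹ leaves the set of ranks unchanged. -/
theorem firstPositions_map {N n : ℕ} (π θ : Equiv.Perm (Fin N)) (T T' : Finset (Fin N))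
    (hT : T' = T.map θ.toEmbedding) (h : n ≤ T.card) (h' : n ≤ T'.card) (k : Fin n) :
    firstPositions (θ.symm.trans π) T' h' k = θ (firstPositions π T h k) := by
  subst hT
  have hm : (T.map θ.toEmbedding).map (θ.symm.trans π).toEmbedding = T.map π.toEmbedding := by
    ext i
    rw [Finset.mem_map_equiv, Finset.mem_map_equiv, Finset.mem_map_equiv]
    simp
  have key : ∀ (S S' : Finset (Fin N)) (m m' : ℕ) (hS : S.card = m) (hS' : S'.card = m')
      (_ : S = S') (hn : n ≤ m) (hn' : n ≤ m'),
      S.orderEmbOfFin hS (Fin.castLE hn k) = S'.orderEmbOfFin hS' (Fin.castLE hn' k) := by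
    rintro S _ m m' rfl rfl rfl hn hn'
    rfl
  simp only [firstPositions, Equiv.symm_trans_apply, Equiv.symm_symm]
  rw [key _ _ _ _ (Finset.card_map _) (Finset.card_map _) hm]

theorem Setting.testPos_act (θ : Equiv.Perm (Fin pr.N)) (τ : Setting pr bt) :
    (τ.act θ).testPos = θ ∘ τ.testPos := by
  funext k
  refine firstPositions_map τ.π θ _ _ ?_ τ.enough_in (τ.act θ).enough_in k
  rw [agree_act, Finset.map_inter]
  rfl

theorem Setting.keyPos_act (θ : Equiv.Perm (Fin pr.N)) (τ : Setting pr bt) :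
    (τ.act θ).keyPos = θ ∘ τ.keyPos := by
  funext k
  refine firstPositions_map τ.π θ _ _ ?_ τ.enough_out (τ.act θ).enough_out k
  rw [agree_act, Finset.map_inter]
  congr 1
  ext i
  simp [act, Finset.mem_map_equiv]

theorem Setting.testPos_mem (τ : Setting pr bt) (k : Fin pr.n) :
    τ.testPos k ∈ agree bt τ.a τ.R ∩ τ.R := firstPositions_mem _ _ _ _

theorem Setting.keyPos_mem (τ : Setting pr bt) (k : Fin pr.n) :
    τ.keyPos k ∈ agree bt τ.a τ.R ∩ τ.Rᶜ := firstPositions_mem _ _ _ _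

theorem Setting.pos_injective (τ : Setting pr bt) :
    Function.Injective (Sum.elim τ.testPos τ.keyPos) := by
  refine (firstPositions_injective _ _ _).sumElim (firstPositions_injective _ _ _) fun k l h => ?_
  have h1 := (Finset.mem_inter.mp (τ.testPos_mem k)).2
  have h2 := (Finset.mem_inter.mp (τ.keyPos_mem l)).2
  rw [Finset.mem_compl] at h2
  exact h2 (h ▸ h1)

/-- An enumeration of all positions that begins with an injective family. -/
theorem exists_enumeration {α : Type*} {N : ℕ} {f : α → Fin N} (hf : Function.Injective f) :
    ∃ e : α ⊕ ((Set.range f)ᶜ : Set (Fin N)) ≃ Fin N, ∀ x, e (.inl x) = f x := by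
  classical
  exact ⟨((Equiv.ofInjective f hf).sumCongr (Equiv.refl _)).trans (Equiv.Set.sumCompl _),
    fun x => by simp⟩

/-- Exchange the `k`-th elements of two lists unless `u k`. -/
def swapFst {n N : ℕ} (u : Fin n → Bool) (p q : Fin n → Fin N) : Fin n → Fin N :=
  fun k => if u k then p k else q k

/-- The exchanges form an involution of the two lists, extended by the identity to the other
positions. -/
theorem exists_swap {n N : ℕ} {p q : Fin n → Fin N} (h : Function.Injective (Sum.elim p q))
    (u : Fin n → Bool) :
    ∃ θ : Equiv.Perm (Fin N), θ ∘ p = swapFst u p q ∧ θ ∘ q = swapFst u q p := by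
  obtain ⟨e, he⟩ := exists_enumeration h
  let f : Fin n ⊕ Fin n → Fin n ⊕ Fin n :=
    Sum.elim (fun k => if u k then .inl k else .inr k) (fun k => if u k then .inr k else .inl k)
  have hf : Function.Involutive f := by
    rintro (k | k) <;> by_cases hk : u k <;> simp [f, hk]
  refine ⟨e.symm.trans (((hf.toPerm f).sumCongr (Equiv.refl _)).trans e), funext fun k => ?_,
    funext fun k => ?_⟩
  · have hp : e (.inl (.inl k)) = p k := he (.inl k)
    have hp' : e.symm (p k) = .inl (.inl k) := by rw [← hp, e.symm_apply_apply]
    by_cases hk : u k <;> simp [swapFst, hk, f, he, hp']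
  · have hq : e (.inl (.inr k)) = q k := he (.inr k)
    have hq' : e.symm (q k) = .inl (.inr k) := by rw [← hq, e.symm_apply_apply]
    by_cases hk : u k <;> simp [swapFst, hk, f, he, hq']

/-- Averaging over the settings, a bound for averages over swaps is sufficient. -/
theorem sum_setting_le (Φ : (Fin pr.n → Fin pr.N) → (Fin pr.n → Fin pr.N) → ℝ) (C : ℝ)
    (hΦ : ∀ p q, Function.Injective (Sum.elim p q) →
      ∑ u : Fin pr.n → Bool, Φ (swapFst u p q) (swapFst u q p) ≤ 2 ^ pr.n * C) :
    ∑ τ : Setting pr bt, Φ τ.testPos τ.keyPos ≤ Fintype.card (Setting pr bt) * C := by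
  set M : ℝ := (Fintype.card (Equiv.Perm (Fin pr.N)) : ℝ) with hM
  have hM0 : 0 < M := by rw [hM]; exact_mod_cast Fintype.card_pos
  have h2 : (0 : ℝ) < 2 ^ pr.n := by positivity
  have hact : ∀ θ : Equiv.Perm (Fin pr.N), ∑ τ : Setting pr bt, Φ (θ ∘ τ.testPos) (θ ∘ τ.keyPos)
      = ∑ τ : Setting pr bt, Φ τ.testPos τ.keyPos := by
    -- An injective action on a finite set permutes the settings, so the sum is unchanged.
    intro θ
    rw [← (Finite.injective_iff_bijective.mp (Setting.act_injective (bt := bt) θ)).sum_comp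
      fun τ => Φ τ.testPos τ.keyPos]
    simp only [Setting.testPos_act, Setting.keyPos_act]
  have hswap : ∀ (τ : Setting pr bt) (u : Fin pr.n → Bool),
      ∑ θ : Equiv.Perm (Fin pr.N), Φ (θ ∘ τ.testPos) (θ ∘ τ.keyPos)
      = ∑ θ : Equiv.Perm (Fin pr.N), Φ (swapFst u (θ ∘ τ.testPos) (θ ∘ τ.keyPos))
          (swapFst u (θ ∘ τ.keyPos) (θ ∘ τ.testPos)) := by
    intro τ u
    obtain ⟨θ', h1, h2⟩ := exists_swap τ.pos_injective u
    -- Substituting θθ' for θ, where θ' realizes the exchanges, puts them inside the sum over all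
    -- permutations.
    rw [← Equiv.sum_comp (Equiv.mulRight θ')]
    refine Finset.sum_congr rfl fun θ _ => ?_
    have e1 : ⇑((Equiv.mulRight θ') θ) ∘ τ.testPos = θ ∘ (θ' ∘ τ.testPos) := rfl
    have e2 : ⇑((Equiv.mulRight θ') θ) ∘ τ.keyPos = θ ∘ (θ' ∘ τ.keyPos) := rfl
    have e3 : ∀ p q : Fin pr.n → Fin pr.N, θ ∘ swapFst u p q = swapFst u (θ ∘ p) (θ ∘ q) := by
      intro p q
      funext k
      by_cases hk : u k <;> simp [swapFst, hk]
    rw [e1, e2, h1, h2, e3, e3]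
  have hτ : ∀ τ : Setting pr bt,
      ∑ θ : Equiv.Perm (Fin pr.N), Φ (θ ∘ τ.testPos) (θ ∘ τ.keyPos) ≤ M * C := by
    intro τ
    have h1 : ∑ _u : Fin pr.n → Bool, ∑ θ : Equiv.Perm (Fin pr.N),
        Φ (θ ∘ τ.testPos) (θ ∘ τ.keyPos) ≤ ∑ _θ : Equiv.Perm (Fin pr.N), 2 ^ pr.n * C := by
      rw [Finset.sum_congr rfl fun u _ => hswap τ u, Finset.sum_comm]
      refine Finset.sum_le_sum fun θ _ => hΦ _ _ ?_
      rw [← Sum.comp_elim]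
      exact θ.injective.comp τ.pos_injective
    simp only [Finset.sum_const, Finset.card_univ, Fintype.card_fun, Fintype.card_bool,
      Fintype.card_fin, nsmul_eq_mul, Nat.cast_pow, Nat.cast_ofNat, ← hM] at h1
    nlinarith
  have hsum := Finset.sum_le_sum fun (τ : Setting pr bt) (_ : τ ∈ Finset.univ) => hτ τ
  rw [Finset.sum_comm, Finset.sum_congr rfl fun θ _ => hact θ] at hsum
  simp only [Finset.sum_const, Finset.card_univ, nsmul_eq_mul, ← hM] at hsum
  nlinarith

end Sampling

/-! ### Averaging the product operator over exchanges -/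

section PairAverage

variable {ι : Type*} [Fintype ι] {ρ P Pt : ZMod 2 → ZMod 2 → Matrix ι ι ℂ} {β γ : ℝ} {N n : ℕ}

/-- The tensor product of `testOp` on the positions `p`, `keyOp` on the positions `q` and `H`
elsewhere. -/
noncomputable def weighted (ρ Pt : ZMod 2 → ZMod 2 → Matrix ι ι ℂ) (s : ℝ) (bt h : Fin N → ZMod 2)
    (p q : Fin n → Fin N) : Matrix (Fin N → ι) (Fin N → ι) ℂ :=
  tensorMatrix fun i =>
    if i ∈ Finset.univ.image p then testOp ρ s (bt i) (h i)
    else if i ∈ Finset.univ.image q then keyOp ρ Pt s (bt i) (h i)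
    else IsQuasiperfect.total ρ

theorem IsQuasiperfect.testOp_nonneg [DecidableEq ι] (hs : IsQuasiperfect ρ P Pt β γ) (s : ℝ) (a h : ZMod 2) :
    0 ≤ testOp ρ s a h :=
  add_nonneg (hs.nonneg _ _) (ofReal_smul_nonneg (Real.exp_pos _).le (hs.nonneg _ _))

theorem IsQuasiperfect.keyOp_nonneg [DecidableEq ι] (hs : IsQuasiperfect ρ P Pt β γ) (s : ℝ) (a h : ZMod 2) :
    0 ≤ keyOp ρ Pt s a h :=
  add_nonneg (hs.projT_sandwich_nonneg _ _)
    (ofReal_smul_nonneg (Real.exp_pos _).le (hs.projT_sandwich_nonneg _ _))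

/-- The bits of `bt` and `h` stay attached to their positions; an exchange only decides which member
of the pair carries `testOp` and which `keyOp`. -/
theorem weighted_swap {κ : Type*} [Fintype κ] (e : (Fin n ⊕ Fin n) ⊕ κ ≃ Fin N) (s : ℝ)
    (bt h : Fin N → ZMod 2) {p q : Fin n → Fin N} (hp : ∀ k, e (.inl (.inl k)) = p k)
    (hq : ∀ k, e (.inl (.inr k)) = q k) (u : Fin n → Bool) :
    weighted ρ Pt s bt h (swapFst u p q) (swapFst u q p) =
      pairTensor e (fun k => if u k
        then testOp ρ s (bt (p k)) (h (p k)) ⊗ₖ keyOp ρ Pt s (bt (q k)) (h (q k))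
        else keyOp ρ Pt s (bt (p k)) (h (p k)) ⊗ₖ testOp ρ s (bt (q k)) (h (q k)))
        fun _ => IsQuasiperfect.total ρ := by
  have hpp : ∀ k l, p k = p l ↔ k = l := fun k l => by rw [← hp, ← hp]; simp
  have hqq : ∀ k l, q k = q l ↔ k = l := fun k l => by rw [← hq, ← hq]; simp
  have hpq : ∀ k l, p k ≠ q l := fun k l => by rw [← hp, ← hq]; simp
  have hqp : ∀ k l, q k ≠ p l := fun k l => (hpq l k).symm
  have hj : ∀ j k, p k ≠ e (.inr j) := fun j k => by rw [← hp]; simp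
  have hj' : ∀ j k, q k ≠ e (.inr j) := fun j k => by rw [← hq]; simp
  have memp : ∀ k, p k ∈ Finset.univ.image (swapFst u p q) ↔ u k = true := fun k => by
    simp only [Finset.mem_image, Finset.mem_univ, true_and, swapFst]
    refine ⟨fun ⟨l, hl⟩ => ?_, fun hk => ⟨k, by simp [hk]⟩⟩
    by_cases hu : u l
    · rw [if_pos hu, hpp] at hl; exact hl ▸ hu
    · rw [if_neg hu] at hl; exact absurd hl (hqp _ _)
  have memp' : ∀ k, p k ∈ Finset.univ.image (swapFst u q p) ↔ u k ≠ true := fun k => by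
    simp only [Finset.mem_image, Finset.mem_univ, true_and, swapFst]
    refine ⟨fun ⟨l, hl⟩ => ?_, fun hk => ⟨k, by simp [hk]⟩⟩
    by_cases hu : u l
    · rw [if_pos hu] at hl; exact absurd hl (hqp _ _)
    · rw [if_neg hu, hpp] at hl; exact hl ▸ hu
  have memq : ∀ k, q k ∈ Finset.univ.image (swapFst u p q) ↔ u k ≠ true := fun k => by
    simp only [Finset.mem_image, Finset.mem_univ, true_and, swapFst]
    refine ⟨fun ⟨l, hl⟩ => ?_, fun hk => ⟨k, by simp [hk]⟩⟩
    by_cases hu : u l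
    · rw [if_pos hu] at hl; exact absurd hl (hpq _ _)
    · rw [if_neg hu, hqq] at hl; exact hl ▸ hu
  have memq' : ∀ k, q k ∈ Finset.univ.image (swapFst u q p) ↔ u k = true := fun k => by
    simp only [Finset.mem_image, Finset.mem_univ, true_and, swapFst]
    refine ⟨fun ⟨l, hl⟩ => ?_, fun hk => ⟨k, by simp [hk]⟩⟩
    by_cases hu : u l
    · rw [if_pos hu, hqq] at hl; exact hl ▸ hu
    · rw [if_neg hu] at hl; exact absurd hl (hpq _ _)
  have memj : ∀ j, e (.inr j) ∉ Finset.univ.image (swapFst u p q) := fun j => by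
    simp only [Finset.mem_image, Finset.mem_univ, true_and, swapFst, not_exists]
    intro k
    split_ifs
    exacts [hj j k, hj' j k]
  have memj' : ∀ j, e (.inr j) ∉ Finset.univ.image (swapFst u q p) := fun j => by
    simp only [Finset.mem_image, Finset.mem_univ, true_and, swapFst, not_exists]
    intro k
    split_ifs
    exacts [hj' j k, hj j k]
  rw [weighted, tensorMatrix_eq_pairTensor e]
  congr 1
  · funext k
    rw [hp, hq]
    by_cases hk : u k
    · rw [if_pos ((memp k).mpr hk), if_neg (fun h => (memq k).mp h hk), if_pos ((memq' k).mpr hk),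
        if_pos hk]
    · rw [if_neg (fun h => hk ((memp k).mp h)), if_pos ((memp' k).mpr hk),
        if_pos ((memq k).mpr hk), if_neg hk]
  · funext j
    rw [if_neg (memj j), if_neg (memj' j)]

/-- Distributivity turns the sum over exchanges into one product over pairs. The pair bound replaces
it by an operator independent of `h`, and completeness of the `E h` then leaves only its trace. -/
theorem sum_swap_le [DecidableEq ι] (hs : IsQuasiperfect ρ P Pt β γ) {s : ℝ} (hs0 : 0 ≤ s) (bt : Fin N → ZMod 2)
    {E : (Fin N → ZMod 2) → Matrix (Fin N → ι) (Fin N → ι) ℂ} (hE0 : ∀ h, 0 ≤ E h)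
    (hE : ∑ h, E h = 1) {p q : Fin n → Fin N} (hpq : Function.Injective (Sum.elim p q)) :
    ∑ u : Fin n → Bool, ∑ h, (E h * weighted ρ Pt s bt h (swapFst u p q) (swapFst u q p)).trace.re ≤
      2 ^ n * (2 ^ N * (Real.cosh s *
        ((1 + β * (Real.exp s - 1)) * (1 + γ / 2 * (Real.exp s - 1)))) ^ n) := by
  classical
  obtain ⟨K, t, hK, ht⟩ := exists_pair_bound hs hs0
  obtain ⟨e, he⟩ := exists_enumeration hpq
  have hp : ∀ k, e (.inl (.inl k)) = p k := fun k => he _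
  have hq : ∀ k, e (.inl (.inr k)) = q k := fun k => he _
  set B := Real.cosh s * ((1 + β * (Real.exp s - 1)) * (1 + γ / 2 * (Real.exp s - 1))) with hB
  have hK0 : ∀ a a', 0 ≤ K a a' := fun a a' =>
    (add_nonneg (kronecker_nonneg (hs.testOp_nonneg s a 0) (hs.keyOp_nonneg s a' 0))
      (kronecker_nonneg (hs.keyOp_nonneg s a 0) (hs.testOp_nonneg s a' 0))).trans (hK a a' 0 0)
  have ht0 : ∀ a a', 0 ≤ t a a' := fun a a' => by
    have := (Matrix.nonneg_iff_posSemidef.mp (hK0 a a')).trace_nonneg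
    rwa [(ht a a').1, Complex.zero_le_real] at this
  set T := pairTensor e (fun k => K (bt (p k)) (bt (q k))) (fun _ => IsQuasiperfect.total ρ) with hT
  have hcard : 2 * n + Fintype.card ((Set.range (Sum.elim p q))ᶜ : Set (Fin N)) = N := by
    have := Fintype.card_congr e
    simp only [Fintype.card_sum, Fintype.card_fin] at this
    omega
  have hsum : ∀ h, ∑ u : Fin n → Bool, weighted ρ Pt s bt h (swapFst u p q) (swapFst u q p) ≤ T := by
    intro h
    simp only [weighted_swap e s bt h hp hq]
    have := sum_pairTensor e (fun b k => if b
        then testOp ρ s (bt (p k)) (h (p k)) ⊗ₖ keyOp ρ Pt s (bt (q k)) (h (q k))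
        else keyOp ρ Pt s (bt (p k)) (h (p k)) ⊗ₖ testOp ρ s (bt (q k)) (h (q k)))
        fun _ => IsQuasiperfect.total ρ
    refine this.trans_le (pairTensor_mono e (fun k => ?_) (fun k => ?_) fun _ => hs.total_nonneg)
    · exact add_nonneg (kronecker_nonneg (hs.testOp_nonneg _ _ _) (hs.keyOp_nonneg _ _ _))
        (kronecker_nonneg (hs.keyOp_nonneg _ _ _) (hs.testOp_nonneg _ _ _))
    · exact hK _ _ _ _
  calc ∑ u : Fin n → Bool, ∑ h, (E h * weighted ρ Pt s bt h (swapFst u p q) (swapFst u q p)).trace.re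
      = ∑ h, (E h * ∑ u : Fin n → Bool,
          weighted ρ Pt s bt h (swapFst u p q) (swapFst u q p)).trace.re := by
        rw [Finset.sum_comm]
        simp only [Finset.mul_sum, Matrix.trace_sum, Complex.re_sum]
    _ ≤ ∑ h, (E h * T).trace.re := Finset.sum_le_sum fun h _ => re_trace_mul_le (hE0 h) (hsum h)
    _ = T.trace.re := by
        rw [← Complex.re_sum, ← Matrix.trace_sum, ← Finset.sum_mul, hE, one_mul]
    _ = (∏ k, t (bt (p k)) (bt (q k))) *
          2 ^ Fintype.card ((Set.range (Sum.elim p q))ᶜ : Set (Fin N)) := by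
        have : T.trace = (((∏ k, t (bt (p k)) (bt (q k))) *
          2 ^ Fintype.card ((Set.range (Sum.elim p q))ᶜ : Set (Fin N)) : ℝ) : ℂ) := by
          rw [hT, trace_pairTensor]
          simp [(ht _ _).1, hs.trace_total]
        rw [this, Complex.ofReal_re]
    _ ≤ (8 * B) ^ n * 2 ^ Fintype.card ((Set.range (Sum.elim p q))ᶜ : Set (Fin N)) := by
        refine mul_le_mul_of_nonneg_right ?_ (by positivity)
        calc _ ≤ ∏ _k : Fin n, 8 * B :=
              Finset.prod_le_prod (fun _ _ => ht0 _ _) fun _ _ => (ht _ _).2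
          _ = _ := by simp
    -- Each pair supplies 8 = 2 · 2²: a factor 2 from its two exchanges and a factor Tr H = 2 for
    -- each of its positions.
    _ = 2 ^ n * (2 ^ N * B ^ n) := by
        conv_rhs => rw [← hcard]
        rw [pow_add, pow_mul, mul_pow, show (8 : ℝ) = 2 * 2 ^ 2 by norm_num, mul_pow]
        ring

end PairAverage

/-! ### Scalar exponential estimates -/

section Exponential

open MeasureTheory ProbabilityTheory in
/-- Hoeffding's bound for the moment generating function of a Bernoulli variable; it is also true
if the parameter is more than `1`. -/
theorem one_add_mul_exp_sub_one_le {x : ℝ} (hx : 0 ≤ x) (s : ℝ) :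
    1 + x * (Real.exp s - 1) ≤ Real.exp (s * x + s ^ 2 / 8) := by
  rcases le_total 1 x with h1 | h1
  -- Beyond 1 there is no Bernoulli variable, but Bernoulli's inequality gives 1 + x(exp s - 1) ≤
  -- exp(sx). The case is needed since `β` and `γ / 2` are only upper bounds.
  · have h := one_add_mul_self_le_rpow_one_add (s := Real.exp s - 1) (p := x)
      (by linarith [Real.exp_pos s]) h1
    rw [add_sub_cancel, ← Real.exp_mul] at h
    exact h.trans (Real.exp_le_exp.mpr (by nlinarith [sq_nonneg s]))
  · let μ : Measure Bool := ENNReal.ofReal x • Measure.dirac true +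
      ENNReal.ofReal (1 - x) • Measure.dirac false
    have hμ : IsProbabilityMeasure μ := ⟨by
      simp [μ, ← ENNReal.ofReal_add hx (sub_nonneg.mpr h1)]⟩
    have hint : ∀ f : Bool → ℝ, ∫ b, f b ∂μ = x * f true + (1 - x) * f false := by
      intro f
      have hi : ∀ b : Bool, ∀ c : ℝ, Integrable f (ENNReal.ofReal c • Measure.dirac b) :=
        fun b c =>
          have := Measure.smul_finite (Measure.dirac b) (ENNReal.ofReal_ne_top (r := c))
          Integrable.of_finite
      rw [integral_add_measure (hi _ _) (hi _ _), integral_smul_measure, integral_smul_measure,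
        integral_dirac, integral_dirac, ENNReal.toReal_ofReal hx,
        ENNReal.toReal_ofReal (sub_nonneg.mpr h1)]
      simp
    let X : Bool → ℝ := fun b => if b then 1 else 0
    -- Hoeffding's lemma for the centred Bernoulli variable; `e1` below undoes the centring.
    have hX := hasSubgaussianMGF_of_mem_Icc (μ := μ) (X := X) (a := 0) (b := 1)
      (measurable_of_finite X).aemeasurable (by
        refine Filter.Eventually.of_forall fun b => ?_
        cases b <;> simp [X])
    have h := hX.mgf_le s
    rw [mgf, hint, hint] at h
    simp only [X] at h
    norm_num at h
    have e1 : 1 + x * (Real.exp s - 1) = Real.exp (s * x) *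
        (x * Real.exp (s * (1 - x)) + (1 - x) * Real.exp (-(s * x))) := by
      have h3 : Real.exp (s * x) * Real.exp (s * (1 - x)) = Real.exp s := by
        rw [← Real.exp_add]; ring_nf
      have h4 : Real.exp (s * x) * Real.exp (-(s * x)) = 1 := by
        rw [← Real.exp_add]; simp
      linear_combination -x * h3 - (1 - x) * h4
    rw [e1, Real.exp_add]
    refine mul_le_mul_of_nonneg_left (h.trans (Real.exp_le_exp.mpr ?_)) (Real.exp_pos _).le
    linarith

/-- The second-order terms add to (1/2 + 1/8 + 1/8)ε² = (3/4)ε² per pair, against the margin (3/2)ε²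
from `hT`. The exponent is at most -(3/4)ε²n, so the second term of `gBound` alone suffices. -/
theorem exp_mul_pow_le_gBound {n : ℕ} {δ T ε x y : ℝ} (hε : 0 ≤ ε) (hx : 0 ≤ x) (hy : 0 ≤ y)
    (hT : (δ + x + y + 3 / 2 * ε) * n ≤ T) :
    Real.exp (ε * (δ * n)) * Real.exp (-ε * T) * (Real.cosh ε * ((1 + x * (Real.exp ε - 1)) *
      (1 + y * (Real.exp ε - 1)))) ^ n ≤ gBound n ε := by
  have he : 0 ≤ Real.exp ε - 1 := by linarith [Real.one_le_exp hε]
  have h1 : Real.cosh ε * ((1 + x * (Real.exp ε - 1)) * (1 + y * (Real.exp ε - 1))) ≤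
      Real.exp (ε ^ 2 / 2 + ((ε * x + ε ^ 2 / 8) + (ε * y + ε ^ 2 / 8))) := by
    rw [Real.exp_add, Real.exp_add]
    have := one_add_mul_exp_sub_one_le hx ε
    have := one_add_mul_exp_sub_one_le hy ε
    have := Real.cosh_le_exp_half_sq ε
    have := (Real.cosh_pos ε).le
    gcongr
  calc _ ≤ Real.exp (ε * (δ * n)) * Real.exp (-ε * T) *
        Real.exp (ε ^ 2 / 2 + ((ε * x + ε ^ 2 / 8) + (ε * y + ε ^ 2 / 8))) ^ n := by
        have := (Real.cosh_pos ε).le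
        gcongr
    _ = Real.exp (ε * (δ * n) + -ε * T +
        n * (ε ^ 2 / 2 + ((ε * x + ε ^ 2 / 8) + (ε * y + ε ^ 2 / 8)))) := by
        rw [← Real.exp_nat_mul, ← Real.exp_add, ← Real.exp_add]
    _ ≤ Real.exp (-(ε ^ 2 * n / 2)) := by
        refine Real.exp_le_exp.mpr ?_
        have := mul_le_mul_of_nonneg_left hT hε
        have h3 : 0 ≤ ε ^ 2 * (n : ℝ) := by positivity
        nlinarith
    _ ≤ gBound n ε := le_add_of_nonneg_left (Real.exp_pos _).le

end Exponential

/-! ### Exponential weights in the Hamming distance -/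

section Distance

variable {ι : Type*} {N : ℕ}

theorem sum_zmod_two {M : Type*} [AddCommMonoid M] (f : ZMod 2 → M) (h : ZMod 2) :
    ∑ b, f b = f h + f (h + 1) := by
  have h11 : (1 : ZMod 2) + 1 = 0 := rfl
  have : ∑ b, f b = f 0 + f 1 := Fin.sum_univ_two f
  obtain rfl | rfl := zmod_two_cases h <;> simp [this, h11, add_comm]

theorem exp_mul_distOn (s : ℝ) (S : Finset (Fin N)) (w h : Fin N → ZMod 2) :
    Real.exp (s * distOn S w h) = ∏ i, if i ∈ S ∧ w i ≠ h i then Real.exp s else 1 := by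
  rw [Finset.prod_ite, Finset.prod_const_one, mul_one, Finset.prod_const, ← Real.exp_nat_mul,
    mul_comm, distOn]
  congr 4
  ext i
  simp

/-- The weight exp(s d) is a product over positions, so the sum over strings factorizes. -/
theorem sum_exp_smul_tensorMatrix (s : ℝ) (S : Finset (Fin N)) (h : Fin N → ZMod 2)
    (t : Fin N → Finset (ZMod 2)) (A : Fin N → ZMod 2 → Matrix ι ι ℂ) :
    ∑ w ∈ Fintype.piFinset t, ((Real.exp (s * distOn S w h) : ℝ) : ℂ) •
        tensorMatrix (fun i => A i (w i)) =
      tensorMatrix fun i => ∑ b ∈ t i,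
        (((if i ∈ S ∧ b ≠ h i then Real.exp s else 1 : ℝ)) : ℂ) • A i b := by
  rw [tensorMatrix_sum]
  refine Finset.sum_congr rfl fun w _ => ?_
  rw [tensorMatrix_smul, exp_mul_distOn, Complex.ofReal_prod]

end Distance

/-! ### The weighted states and the projection onto distant strings -/

section Test

variable {ι : Type*} [Fintype ι] [DecidableEq ι] {ρ P Pt : ZMod 2 → ZMod 2 → Matrix ι ι ℂ}
  {β γ : ℝ} {N : ℕ}

theorem IsQuasiperfect.sum_exp_smul_state (hs : IsQuasiperfect ρ P Pt β γ) (s : ℝ)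
    (S : Finset (Fin N)) (a h : Fin N → ZMod 2) :
    ∑ g, ((Real.exp (-s * distOn S g h) : ℝ) : ℂ) • tensorMatrix (fun i => ρ (a i) (g i)) =
      tensorMatrix fun i => if i ∈ S then testOp ρ s (a i) (h i) else total ρ := by
  rw [← Fintype.piFinset_univ, sum_exp_smul_tensorMatrix (-s) S h _ fun i => ρ (a i)]
  congr 1
  funext i
  by_cases hi : i ∈ S
  · rw [if_pos hi, sum_zmod_two _ (h i)]
    simp [hi, testOp]
  · simp [hi, hs.sum_eq_total]

open Classical in
/-- The projection onto the strings whose distance to `h` on `S` is at least `c`. -/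
noncomputable def farProj (Pt : ZMod 2 → ZMod 2 → Matrix ι ι ℂ) (bt : Fin N → ZMod 2)
    (S : Finset (Fin N)) (h : Fin N → ZMod 2) (c : ℝ) : Matrix (Fin N → ι) (Fin N → ι) ℂ :=
  ∑ w ∈ Finset.univ.filter (fun w : Fin N → ZMod 2 => c ≤ (distOn S w h : ℝ)),
    tensorMatrix fun i => Pt (bt i) (w i)

theorem IsQuasiperfect.farProj_conjTranspose (hs : IsQuasiperfect ρ P Pt β γ)
    (bt : Fin N → ZMod 2) (S : Finset (Fin N)) (h : Fin N → ZMod 2) (c : ℝ) :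
    (farProj Pt bt S h c)ᴴ = farProj Pt bt S h c := by
  simp only [farProj, Matrix.conjTranspose_sum, tensorMatrix_conjTranspose, hs.projT_conjTranspose]

/-- The strings that vanish outside of `S`. -/
def supported (S : Finset (Fin N)) : Finset (Fin N → ZMod 2) :=
  Fintype.piFinset fun i => if i ∈ S then Finset.univ else {0}

open Classical in
-- The distance sees only the positions in `S`; summing over the other bits gives the identity
-- there. The strings of `supported S` serve as representatives of the restrictions to `S`.
theorem IsQuasiperfect.farProj_eq (hs : IsQuasiperfect ρ P Pt β γ)
    (bt : Fin N → ZMod 2) (S : Finset (Fin N)) (h : Fin N → ZMod 2) (c : ℝ) :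
    farProj Pt bt S h c = ∑ u ∈ (supported S).filter (fun u => c ≤ (distOn S u h : ℝ)),
      tensorMatrix fun i => if i ∈ S then Pt (bt i) (u i) else 1 := by
  let r : (Fin N → ZMod 2) → Fin N → ZMod 2 := fun w i => if i ∈ S then w i else 0
  have hr : ∀ w, distOn S (r w) h = distOn S w h := fun w => by
    unfold distOn
    congr 1
    refine Finset.filter_congr fun i hi => ?_
    simp [r, hi]
  have hmem : ∀ w, r w ∈ supported S := fun w => by
    rw [supported, Fintype.mem_piFinset]
    intro i
    by_cases hi : i ∈ S <;> simp [r, hi]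
  rw [farProj, ← Finset.sum_fiberwise_of_maps_to (g := r)
    (t := (supported S).filter (fun u => c ≤ (distOn S u h : ℝ)))]
  · refine Finset.sum_congr rfl fun u hu => ?_
    rw [Finset.mem_filter, supported, Fintype.mem_piFinset] at hu
    have hset : (Finset.univ.filter fun w : Fin N → ZMod 2 => c ≤ (distOn S w h : ℝ)).filter
        (fun w => r w = u) = Fintype.piFinset fun i => if i ∈ S then {u i} else Finset.univ := by
      ext w
      rw [Finset.mem_filter, Finset.mem_filter, Fintype.mem_piFinset]
      constructor
      · rintro ⟨-, rfl⟩ i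
        by_cases hi : i ∈ S <;> simp [r, hi]
      · intro hw
        have hru : r w = u := by
          funext i
          by_cases hi : i ∈ S
          · simpa [r, hi] using hw i
          · simpa [r, hi, eq_comm] using hu.1 i
        refine ⟨⟨Finset.mem_univ _, ?_⟩, hru⟩
        rw [← hr, hru]
        exact hu.2
    rw [hset, ← tensorMatrix_sum (fun i => if i ∈ S then {u i} else Finset.univ) fun i => Pt (bt i)]
    congr 1
    funext i
    by_cases hi : i ∈ S
    · simp [hi]
    · rw [if_neg hi, if_neg hi, sum_zmod_two _ 0]
      exact hs.projT_add _ 0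
  · intro w hw
    rw [Finset.mem_filter] at hw ⊢
    exact ⟨hmem w, by rw [hr]; exact hw.2⟩

/-- Cross terms of two different strings contain P̃_h H P̃_{h+1} = 0 at some position of `S`. The
diagonal terms are positive, so each may be multiplied by exp(s(d - c)) ≥ 1 and the sum extended to
all strings, where it factorizes. -/
theorem IsQuasiperfect.farProj_sandwich_le (hs : IsQuasiperfect ρ P Pt β γ)
    (bt : Fin N → ZMod 2) (S : Finset (Fin N)) (h : Fin N → ZMod 2) (c : ℝ) {s : ℝ} (hs0 : 0 ≤ s)
    {Y : Fin N → Matrix ι ι ℂ} (hY : ∀ i, 0 ≤ Y i) (hYS : ∀ i ∈ S, Y i = total ρ) :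
    farProj Pt bt S h c * tensorMatrix Y * farProj Pt bt S h c ≤
      ((Real.exp (-s * c) : ℝ) : ℂ) •
        tensorMatrix fun i => if i ∈ S then keyOp ρ Pt s (bt i) (h i) else Y i := by
  classical
  let Q : (Fin N → ZMod 2) → Matrix (Fin N → ι) (Fin N → ι) ℂ := fun u =>
    tensorMatrix fun i => if i ∈ S then Pt (bt i) (u i) * total ρ * Pt (bt i) (u i) else Y i
  have hQ0 : ∀ u, 0 ≤ Q u := fun u => tensorMatrix_nonneg fun i => by
    by_cases hi : i ∈ S
    · simpa only [hi, if_true] using hs.projT_sandwich_nonneg _ _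
    · simpa only [hi, if_false] using hY i
  have h1 : farProj Pt bt S h c * tensorMatrix Y * farProj Pt bt S h c =
      ∑ u ∈ (supported S).filter (fun u => c ≤ (distOn S u h : ℝ)), Q u := by
    rw [hs.farProj_eq, Finset.sum_mul, Finset.sum_mul]
    refine Finset.sum_congr rfl fun u hu => ?_
    rw [Finset.mul_sum, Finset.sum_eq_single u]
    · rw [tensorMatrix_mul, tensorMatrix_mul]
      congr 1
      funext i
      by_cases hi : i ∈ S
      · simp [hi, hYS]
      · simp [hi]
    · intro u' hu' hne
      rw [tensorMatrix_mul, tensorMatrix_mul]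
      obtain ⟨i, hi⟩ := Function.ne_iff.mp hne
      have hiS : i ∈ S := by
        by_contra hiS
        have e1 := Fintype.mem_piFinset.mp (Finset.mem_filter.mp hu).1 i
        have e2 := Fintype.mem_piFinset.mp (Finset.mem_filter.mp hu').1 i
        simp only [hiS, if_false, Finset.mem_singleton] at e1 e2
        exact hi (e2.trans e1.symm)
      refine tensorMatrix_eq_zero (k := i) ?_
      rw [if_pos hiS, if_pos hiS, hYS i hiS, zmod_two_eq_add_one hi]
      exact hs.projT_orth _ _
    · exact fun hn => absurd hu hn
  have h2 : ∑ u ∈ supported S, ((Real.exp (s * distOn S u h) : ℝ) : ℂ) • Q u =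
      tensorMatrix fun i => if i ∈ S then keyOp ρ Pt s (bt i) (h i) else Y i := by
    rw [supported, sum_exp_smul_tensorMatrix s S h _ fun i b =>
      if i ∈ S then Pt (bt i) b * total ρ * Pt (bt i) b else Y i]
    congr 1
    funext i
    by_cases hi : i ∈ S
    · simp only [hi, if_true, true_and]
      rw [sum_zmod_two _ (h i)]
      simp [keyOp]
    · simp [hi]
  rw [h1, ← h2, Finset.smul_sum]
  calc _ ≤ ∑ u ∈ (supported S).filter (fun u => c ≤ (distOn S u h : ℝ)),
        ((Real.exp (-s * c) : ℝ) : ℂ) • ((Real.exp (s * distOn S u h) : ℝ) : ℂ) • Q u := by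
        refine Finset.sum_le_sum fun u hu => ?_
        have hu2 := (Finset.mem_filter.mp hu).2
        have : 1 ≤ Real.exp (-s * c) * Real.exp (s * distOn S u h) := by
          rw [← Real.exp_add]
          exact Real.one_le_exp (by nlinarith)
        rw [smul_smul, ← Complex.ofReal_mul, ← sub_nonneg]
        convert ofReal_smul_nonneg (sub_nonneg.mpr this) (hQ0 u) using 1
        rw [Complex.ofReal_sub, sub_smul, Complex.ofReal_one, one_smul]
    _ ≤ _ := Finset.sum_le_sum_of_subset_of_nonneg (Finset.filter_subset _ _) fun u _ _ =>
        ofReal_smul_nonneg (Real.exp_pos _).le (ofReal_smul_nonneg (Real.exp_pos _).le (hQ0 u))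

end Test

/-! ### Summing over the views of an attack -/

section Attack

variable {ι : Type*} {ρ P Pt : ZMod 2 → ZMod 2 → Matrix ι ι ℂ}
  {β γ lam : ℝ} {pr : Params} {bt : Fin pr.N → ZMod 2} {J : Type*} {V : Finset (View pr bt J)}
  {F : View pr bt J → Matrix (ClassicalState pr bt × (Fin pr.N → ι))
    (ClassicalState pr bt × (Fin pr.N → ι)) ℂ}

open Classical in
theorem projC_apply (y : Announcement pr bt) (c : ClassicalState pr bt) :
    projC y c c = if announce c = y then 1 else 0 := by
  simp only [projC, Matrix.sum_apply, Matrix.single_apply]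
  by_cases hc : announce c = y
  · rw [if_pos hc, Finset.sum_eq_single c]
    · simp
    · intro d _ hd
      simp [hd]
    · simp [hc]
  · rw [if_neg hc]
    refine Finset.sum_eq_zero fun d hd => ?_
    have : d ≠ c := by
      rintro rfl
      exact hc (Finset.mem_filter.mp hd).2
    simp [this]

/-- The state emitted by the source for a given classical state. -/
noncomputable def emitted (ρ : ZMod 2 → ZMod 2 → Matrix ι ι ℂ) (c : ClassicalState pr bt) :
    Matrix (Fin pr.N → ι) (Fin pr.N → ι) ℂ :=
  tensorMatrix fun i => ρ (c.1.a i) (c.2 i)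

open Classical in
theorem trace_kronecker_systemState [Fintype ι] (y : Announcement pr bt)
    (E Q : Matrix (Fin pr.N → ι) (Fin pr.N → ι) ℂ) :
    ((projC y ⊗ₖ E) * (1 ⊗ₖ Q) * systemState pr bt ρ * (1 ⊗ₖ Q)).trace =
      (Fintype.card (ClassicalState pr bt) : ℂ)⁻¹ *
        ∑ c, if announce c = y then (E * (Q * emitted ρ c * Q)).trace else 0 := by
  simp only [systemState, Finset.mul_sum, Finset.sum_mul, Matrix.mul_smul, Matrix.smul_mul,
    ← Matrix.mul_kronecker_mul, Matrix.trace_sum, Matrix.trace_smul, Matrix.trace_kronecker,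
    mul_one, smul_eq_mul]
  refine Finset.sum_congr rfl fun c _ => ?_
  rw [Matrix.trace_mul_single, projC_apply]
  simp only [mul_assoc, emitted]
  split_ifs <;> simp

theorem proj0_eq_farProj (v : View pr bt J) :
    proj0 Pt γ lam pr.ε v = farProj Pt bt v.1.τ.SK v.2.1
      ((1 / (1 - lam) * pr.δP + γ / 2 + pr.ε) * pr.n) := rfl

theorem Setting.disjoint_SP_SK (τ : Setting pr bt) {i : Fin pr.N} (hi : i ∈ τ.SP) : i ∉ τ.SK := by
  intro hi'
  obtain ⟨k, -, rfl⟩ := Finset.mem_image.mp hi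
  obtain ⟨l, -, h⟩ := Finset.mem_image.mp hi'
  have h1 := (Finset.mem_inter.mp (τ.testPos_mem k)).2
  have h2 := (Finset.mem_inter.mp (τ.keyPos_mem l)).2
  rw [Finset.mem_compl] at h2
  exact h2 (by rwa [show τ.keyPos l = τ.testPos k from h])

theorem Setting.basis_eq_of_mem_SP (τ : Setting pr bt) {i : Fin pr.N} (hi : i ∈ τ.SP) :
    τ.a i = bt i := by
  obtain ⟨k, -, rfl⟩ := Finset.mem_image.mp hi
  have h := Finset.mem_inter.mp (τ.testPos_mem k)
  have h1 := (Finset.mem_filter.mp h.1).2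
  rw [basisB] at h1
  exact h1.trans (if_pos h.2)

theorem distOn_le_of_passes {v : View pr bt J} (hv : Passes v) {c : ClassicalState pr bt}
    (hc : announce c = v.1) : (distOn c.1.SP c.2 v.2.1 : ℝ) ≤ pr.δP * pr.n := by
  obtain ⟨y, h, j⟩ := v
  subst hc
  have h1 : distOn c.1.SP c.2 h ≤ ⌊pr.δP * (pr.n : ℝ)⌋₊ := by
    refine le_trans ?_ hv
    rw [distOn, ← Finset.card_map (Function.Embedding.subtype _)]
    refine Finset.card_le_card fun i hi => ?_
    rw [Finset.mem_filter] at hi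
    exact Finset.mem_map.mpr ⟨⟨i, c.1.disjoint_SP_SK hi.1⟩, Finset.mem_filter.mpr
      ⟨Finset.mem_univ _, hi⟩, rfl⟩
  calc (distOn c.1.SP c.2 h : ℝ) ≤ (⌊pr.δP * (pr.n : ℝ)⌋₊ : ℝ) := by exact_mod_cast h1
    _ ≤ _ := Nat.floor_le (by have := pr.δP_pos; positivity)

open Classical in
-- Reads off the diagonal block at `c` of the identity for the outcome `h`. The result is the same
-- for all `c`: this is how the ignorance of the measurement of `h` enters.
theorem sum_block_eq
    {E : View pr bt J → Matrix (Fin pr.N → ι) (Fin pr.N → ι) ℂ}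
    (hE : ∀ v ∈ V, F v = projC v.1 ⊗ₖ E v) {h : Fin pr.N → ZMod 2}
    {Eh : Matrix (Fin pr.N → ι) (Fin pr.N → ι) ℂ}
    (hEh : ∑ v ∈ V.filter (fun v => v.2.1 = h), F v = 1 ⊗ₖ Eh) (c : ClassicalState pr bt) :
    ∑ v ∈ V.filter (fun v => v.2.1 = h), (if announce c = v.1 then E v else 0) = Eh := by
  ext x y
  have := congrFun (congrFun hEh (c, x)) (c, y)
  rw [Matrix.kroneckerMap_apply, Matrix.one_apply_eq, one_mul] at this
  rw [← this, Matrix.sum_apply, Matrix.sum_apply]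
  refine Finset.sum_congr rfl fun v hv => ?_
  rw [hE v (Finset.mem_filter.mp hv).1, Matrix.kroneckerMap_apply, projC_apply]
  split_ifs <;> simp

variable [Fintype ι] [DecidableEq ι]

open Classical in
theorem IsNormalizedAttack.sum_eq_one (hattack : IsNormalizedAttack ρ V F)
    {Eh : (Fin pr.N → ZMod 2) → Matrix (Fin pr.N → ι) (Fin pr.N → ι) ℂ}
    (hEh : ∀ h, ∑ v ∈ V.filter (fun v => v.2.1 = h), F v = 1 ⊗ₖ Eh h)
    (c : ClassicalState pr bt) : ∑ h, Eh h = 1 := by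
  have h1 : ∑ h, (1 : Matrix (ClassicalState pr bt) (ClassicalState pr bt) ℂ) ⊗ₖ Eh h = 1 := by
    rw [← hattack.povm.sum_eq_one, ← Finset.sum_fiberwise V (fun v => v.2.1)]
    exact Finset.sum_congr rfl fun h _ => (hEh h).symm
  ext x y
  have := congrFun (congrFun h1 (c, x)) (c, y)
  simpa [Matrix.sum_apply, Matrix.kroneckerMap_apply, Matrix.one_apply] using this

theorem IsQuasiperfect.beta_nonneg (hs : IsQuasiperfect ρ P Pt β γ) : 0 ≤ β := by
  have h := hs.proj_mul_nonneg 0 0 (0 + 1)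
  exact (Complex.le_def.mp (Matrix.nonneg_iff_posSemidef.mp h).trace_nonneg).1.trans
    (hs.beta_bound 0 0)

theorem IsQuasiperfect.gamma_nonneg (hs : IsQuasiperfect ρ P Pt β γ) : 0 ≤ γ := by
  refine le_trans ?_ (hs.gamma_bound 0 0)
  refine Multiset.sum_nonneg fun x hx => ?_
  obtain ⟨z, -, rfl⟩ := Multiset.mem_map.mp hx
  exact norm_nonneg z

theorem Conditions.threshold (hcond : Conditions pr β γ lam) (hβ : 0 ≤ β) :
    pr.δP + β + γ / 2 + 3 / 2 * pr.ε ≤ 1 / (1 - lam) * pr.δP + γ / 2 + pr.ε := by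
  have h := hcond.lam_cond
  have hε := pr.ε_pos
  -- At λ = 1 the quotient is 0 by convention, and the condition would force ε/2 + β ≤ 0. Otherwise
  -- 1/(1 - λ) = 1 + λ/(1 - λ), and the excess pays for β and an extra ε/2.
  by_cases hl : 1 - lam = 0
  · rw [hl, div_zero, zero_mul] at h
    linarith
  · have : 1 / (1 - lam) = 1 + lam / (1 - lam) := by field_simp; ring
    rw [this]
    linarith

/-- The averaged state, sandwiched between projections, is dominated by a product operator. -/
theorem IsQuasiperfect.sum_emitted_le (hs : IsQuasiperfect ρ P Pt β γ) (τ : Setting pr bt)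
    (h : Fin pr.N → ZMod 2) (c : ℝ) {s : ℝ} (hs0 : 0 ≤ s) :
    farProj Pt bt τ.SK h c * (∑ g : Fin pr.N → ZMod 2,
      ((Real.exp (-s * distOn τ.SP g h) : ℝ) : ℂ) • emitted ρ (τ, g)) * farProj Pt bt τ.SK h c ≤
    ((Real.exp (-s * c) : ℝ) : ℂ) • weighted ρ Pt s bt h τ.testPos τ.keyPos := by
  have h1 := hs.sum_exp_smul_state s τ.SP τ.a h
  -- On key positions Alice's basis is the complement of `bt`, but after the sum over `g` only `H`
  -- remains, to which the projections for `bt` are adapted.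
  have h2 := hs.farProj_sandwich_le bt τ.SK h c hs0
    (Y := fun i => if i ∈ τ.SP then testOp ρ s (τ.a i) (h i) else total ρ)
    (fun i => by
      split_ifs
      exacts [hs.testOp_nonneg _ _ _, hs.total_nonneg])
    (fun i hi => if_neg fun hi' => τ.disjoint_SP_SK hi' hi)
  have h3 : (tensorMatrix fun i => if i ∈ τ.SK then keyOp ρ Pt s (bt i) (h i)
      else if i ∈ τ.SP then testOp ρ s (τ.a i) (h i) else total ρ) =
      weighted ρ Pt s bt h τ.testPos τ.keyPos := by
    unfold weighted
    congr 1
    funext i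
    change _ = if i ∈ τ.SP then _ else if i ∈ τ.SK then _ else _
    by_cases hi : i ∈ τ.SP
    · simp [hi, τ.disjoint_SP_SK hi, τ.basis_eq_of_mem_SP hi]
    · simp [hi]
  rw [← h3]
  simp only [emitted]
  rwa [h1]

theorem systemState_nonneg (hs : IsQuasiperfect ρ P Pt β γ) : 0 ≤ systemState pr bt ρ := by
  classical
  refine Finset.sum_nonneg fun c _ => ?_
  have h : 0 ≤ (Matrix.single c c (1 : ℂ) ⊗ₖ tensorMatrix fun i => ρ (c.1.a i) (c.2 i)) := by
    refine kronecker_nonneg ?_ (tensorMatrix_nonneg fun i => hs.nonneg _ _)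
    rw [← Matrix.diagonal_single, Matrix.nonneg_iff_posSemidef]
    exact Matrix.PosSemidef.diagonal (by simp [Pi.single_nonneg])
  have := ofReal_smul_nonneg (r := (Fintype.card (ClassicalState pr bt) : ℝ)⁻¹) (by positivity) h
  simpa using this

open Classical in
theorem sum_passes_le (hs : IsQuasiperfect ρ P Pt β γ) (hcond : Conditions pr β γ lam)
    (hattack : IsNormalizedAttack ρ V F) :
    ∑ v ∈ V.filter Passes, (F v * (1 ⊗ₖ proj0 Pt γ lam pr.ε v) * systemState pr bt ρ *
      (1 ⊗ₖ proj0 Pt γ lam pr.ε v)).trace.re ≤ gBound pr.n pr.ε := by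
  -- A possible view provides a classical state; without one, the normalization and the relation ∑
  -- E_h = 1 could not be extracted.
  obtain ⟨v₀, hv₀⟩ : V.Nonempty := by
    by_contra hV
    rw [Finset.not_nonempty_iff_eq_empty] at hV
    have := hattack.prob_passes_pos
    simp [probOf, hV] at this
  obtain ⟨c₀, -⟩ := hattack.possible v₀ hv₀
  choose! E hE0 hEF using hattack.decomp
  choose Eh hEh0 hEh using hattack.decomp_h
  have hEh1 : ∑ h, Eh h = 1 := hattack.sum_eq_one hEh c₀
  have hE0' : ∀ v ∈ V, 0 ≤ E v := fun v hv => Matrix.nonneg_iff_posSemidef.mpr (hE0 v hv)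
  have hEh0' : ∀ h, 0 ≤ Eh h := fun h => Matrix.nonneg_iff_posSemidef.mpr (hEh0 h)
  have hε := pr.ε_pos
  set s := pr.ε with hsdef
  set T : ℝ := (1 / (1 - lam) * pr.δP + γ / 2 + s) * pr.n with hT
  set M : ℝ := (Fintype.card (ClassicalState pr bt) : ℝ) with hM
  have hM0 : 0 < M := by
    have : Nonempty (ClassicalState pr bt) := ⟨c₀⟩
    rw [hM]
    exact_mod_cast Fintype.card_pos
  let Q : ClassicalState pr bt → (Fin pr.N → ZMod 2) → Matrix (Fin pr.N → ι) (Fin pr.N → ι) ℂ :=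
    fun c h => farProj Pt bt c.1.SK h T * emitted ρ c * farProj Pt bt c.1.SK h T
  let w : ClassicalState pr bt → (Fin pr.N → ZMod 2) → ℝ :=
    fun c h => Real.exp (-s * distOn c.1.SP c.2 h)
  have hQ0 : ∀ c h, 0 ≤ Q c h := fun c h => by
    have h1 : 0 ≤ emitted ρ c := tensorMatrix_nonneg fun i => hs.nonneg _ _
    have := (Matrix.nonneg_iff_posSemidef.mp h1).mul_mul_conjTranspose_same
      (farProj Pt bt c.1.SK h T)
    rw [hs.farProj_conjTranspose] at this
    exact Matrix.nonneg_iff_posSemidef.mpr this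
  -- For states compatible with a passing view, the inserted weight is at least 1, because the test
  -- distance is at most δn.
  have hterm : ∀ v ∈ V.filter Passes, (F v * (1 ⊗ₖ proj0 Pt γ lam s v) * systemState pr bt ρ *
      (1 ⊗ₖ proj0 Pt γ lam s v)).trace.re ≤ Real.exp (s * (pr.δP * pr.n)) * M⁻¹ *
        ∑ c, w c v.2.1 * ((if announce c = v.1 then E v else 0) * Q c v.2.1).trace.re := by
    intro v hv
    obtain ⟨hvV, hvP⟩ := Finset.mem_filter.mp hv
    have hcast : (Fintype.card (ClassicalState pr bt) : ℂ)⁻¹ = ((M⁻¹ : ℝ) : ℂ) := by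
      rw [hM]; push_cast; rfl
    rw [hEF v hvV, trace_kronecker_systemState, hcast, Complex.re_ofReal_mul, Complex.re_sum,
      mul_comm (Real.exp _), mul_assoc]
    refine mul_le_mul_of_nonneg_left ?_ (inv_nonneg.mpr hM0.le)
    rw [Finset.mul_sum]
    refine Finset.sum_le_sum fun c _ => ?_
    by_cases hc : announce c = v.1
    · rw [if_pos hc, if_pos hc]
      have hτ : v.1.τ = c.1 := by rw [← hc]; rfl
      have hd := distOn_le_of_passes hvP hc
      rw [proj0_eq_farProj, hτ]
      have h0 := re_trace_mul_nonneg (hE0' v hvV) (hQ0 c v.2.1)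
      have hw : 1 ≤ Real.exp (s * (pr.δP * pr.n)) * w c v.2.1 := by
        rw [← Real.exp_add]
        exact Real.one_le_exp (by nlinarith)
      exact (le_mul_of_one_le_left h0 hw).trans_eq (mul_assoc _ _ _)
    · rw [if_neg hc, if_neg hc]
      simp
  -- Nonnegativity lets the weighted sum run over all views, failing ones included; only then do the
  -- operators add up to `Eh h`.
  have hnn : ∀ v ∈ V, 0 ≤ Real.exp (s * (pr.δP * pr.n)) * M⁻¹ *
        ∑ c, w c v.2.1 * ((if announce c = v.1 then E v else 0) * Q c v.2.1).trace.re := by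
    intro v hv
    refine mul_nonneg (mul_nonneg (Real.exp_pos _).le (inv_nonneg.mpr hM0.le))
      (Finset.sum_nonneg fun c _ => mul_nonneg (Real.exp_pos _).le
        (re_trace_mul_nonneg ?_ (hQ0 _ _)))
    split_ifs
    exacts [hE0' v hv, le_rfl]
  have hregroup : ∑ v ∈ V, ∑ c, w c v.2.1 *
      ((if announce c = v.1 then E v else 0) * Q c v.2.1).trace.re =
      ∑ c, ∑ h, w c h * (Eh h * Q c h).trace.re := by
    rw [Finset.sum_comm]
    refine Finset.sum_congr rfl fun c _ => ?_
    rw [← Finset.sum_fiberwise V (fun v => v.2.1)]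
    refine Finset.sum_congr rfl fun h _ => ?_
    rw [← sum_block_eq hEF (hEh h) c, Finset.sum_mul, Matrix.trace_sum, Complex.re_sum,
      Finset.mul_sum]
    refine Finset.sum_congr rfl fun v hv => ?_
    rw [(Finset.mem_filter.mp hv).2]
  have hsetting : ∀ τ : Setting pr bt, ∑ g, ∑ h, w (τ, g) h * (Eh h * Q (τ, g) h).trace.re ≤
      Real.exp (-s * T) * ∑ h, (Eh h * weighted ρ Pt s bt h τ.testPos τ.keyPos).trace.re := by
    intro τ
    rw [Finset.sum_comm, Finset.mul_sum]
    refine Finset.sum_le_sum fun h _ => ?_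
    have := re_trace_mul_le (hEh0' h) (hs.sum_emitted_le τ h T hε.le)
    rw [Matrix.mul_smul, Matrix.trace_smul, smul_eq_mul, Complex.re_ofReal_mul] at this
    refine le_trans (le_of_eq ?_) this
    simp only [Finset.mul_sum, Finset.sum_mul, Matrix.mul_smul, Matrix.smul_mul, Matrix.trace_sum,
      Matrix.trace_smul, Complex.re_sum, smul_eq_mul, Complex.re_ofReal_mul, w, Q]
  set κ := Real.cosh s * ((1 + β * (Real.exp s - 1)) * (1 + γ / 2 * (Real.exp s - 1))) with hκ
  have hsample := sum_setting_le (bt := bt)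
    (fun p q => ∑ h, (Eh h * weighted ρ Pt s bt h p q).trace.re) (2 ^ pr.N * κ ^ pr.n)
    fun p q hpq => sum_swap_le hs hε.le bt hEh0' hEh1 hpq
  have hcard : M = Fintype.card (Setting pr bt) * 2 ^ pr.N := by
    rw [hM, Fintype.card_prod, Fintype.card_fun, Fintype.card_fin, ZMod.card]
    push_cast
    rfl
  calc _ ≤ ∑ v ∈ V.filter Passes, Real.exp (s * (pr.δP * pr.n)) * M⁻¹ *
        ∑ c, w c v.2.1 * ((if announce c = v.1 then E v else 0) * Q c v.2.1).trace.re :=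
        Finset.sum_le_sum hterm
    _ ≤ ∑ v ∈ V, Real.exp (s * (pr.δP * pr.n)) * M⁻¹ *
        ∑ c, w c v.2.1 * ((if announce c = v.1 then E v else 0) * Q c v.2.1).trace.re :=
        Finset.sum_le_sum_of_subset_of_nonneg (Finset.filter_subset _ _) fun v hv _ => hnn v hv
    _ = Real.exp (s * (pr.δP * pr.n)) * M⁻¹ *
        ∑ τ, ∑ g, ∑ h, w (τ, g) h * (Eh h * Q (τ, g) h).trace.re := by
        rw [← Finset.mul_sum, hregroup, Fintype.sum_prod_type]
    _ ≤ Real.exp (s * (pr.δP * pr.n)) * M⁻¹ *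
        (Real.exp (-s * T) * (Fintype.card (Setting pr bt) * (2 ^ pr.N * κ ^ pr.n))) := by
        refine mul_le_mul_of_nonneg_left ?_
          (mul_nonneg (Real.exp_pos _).le (inv_nonneg.mpr hM0.le))
        refine (Finset.sum_le_sum fun τ _ => hsetting τ).trans ?_
        rw [← Finset.mul_sum]
        exact mul_le_mul_of_nonneg_left hsample (Real.exp_pos _).le
    _ = Real.exp (s * (pr.δP * pr.n)) * Real.exp (-s * T) * κ ^ pr.n * (M⁻¹ * M) := by
        rw [hcard]
        ring
    _ = Real.exp (s * (pr.δP * pr.n)) * Real.exp (-s * T) * κ ^ pr.n := by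
        rw [inv_mul_cancel₀ hM0.ne', mul_one]
    _ ≤ gBound pr.n s := by
        refine exp_mul_pow_le_gBound hε.le hs.beta_nonneg (by linarith [hs.gamma_nonneg]) ?_
        exact mul_le_mul_of_nonneg_right (hcond.threshold hs.beta_nonneg) (Nat.cast_nonneg _)

end Attack

end BB84

/-! ### Markov's inequality -/

theorem mainTheorem6 {ι : Type*} [Fintype ι] [DecidableEq ι]
    (pr : BB84.Params) (ρ P Pt : ZMod 2 → ZMod 2 → Matrix ι ι ℂ) (β γ lam : ℝ)
    (hsource : BB84.IsQuasiperfect ρ P Pt β γ)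
    (hcond : BB84.Conditions pr β γ lam)
    (bt : Fin pr.N → ZMod 2) {J : Type*} (V : Finset (BB84.View pr bt J))
    (F : BB84.View pr bt J → Matrix (BB84.ClassicalState pr bt × (Fin pr.N → ι))
      (BB84.ClassicalState pr bt × (Fin pr.N → ι)) ℂ)
    (hattack : BB84.IsNormalizedAttack ρ V F) :
    BB84.probOf ρ V F BB84.Passes - √(BB84.gBound pr.n pr.ε) ≤
      BB84.probOf ρ V F (BB84.SmallSphere ρ Pt γ lam pr.ε F) := by
  classical
  have hg : 0 < BB84.gBound pr.n pr.ε := add_pos (Real.exp_pos _) (Real.exp_pos _)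
  have hg' : 0 < √(BB84.gBound pr.n pr.ε) := Real.sqrt_pos.mpr hg
  have key := BB84.sum_passes_le hsource hcond hattack
  set t : BB84.View pr bt J → ℝ := fun v => (F v * (1 ⊗ₖ BB84.proj0 Pt γ lam pr.ε v) *
    BB84.systemState pr bt ρ * (1 ⊗ₖ BB84.proj0 Pt γ lam pr.ε v)).trace.re with ht
  have ht0 : ∀ v ∈ V, 0 ≤ t v := by
    intro v hv
    have hQ : (1 ⊗ₖ BB84.proj0 Pt γ lam pr.ε v : Matrix (BB84.ClassicalState pr bt ×
        (Fin pr.N → ι)) (BB84.ClassicalState pr bt × (Fin pr.N → ι)) ℂ)ᴴ =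
        1 ⊗ₖ BB84.proj0 Pt γ lam pr.ε v := by
      rw [Matrix.conjTranspose_kronecker, Matrix.conjTranspose_one, BB84.proj0_eq_farProj,
        hsource.farProj_conjTranspose]
    have h := (Matrix.nonneg_iff_posSemidef.mp (BB84.systemState_nonneg (bt := bt)
      hsource)).mul_mul_conjTranspose_same
      ((1 : Matrix (BB84.ClassicalState pr bt) (BB84.ClassicalState pr bt) ℂ) ⊗ₖ BB84.proj0 Pt γ lam pr.ε v)
    rw [hQ] at h
    have := BB84.re_trace_mul_nonneg
      (Matrix.nonneg_iff_posSemidef.mpr (hattack.povm.posSemidef v hv))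
      (Matrix.nonneg_iff_posSemidef.mpr h)
    simpa only [ht, mul_assoc] using this
  have hterm : ∀ v ∈ V.filter BB84.Passes, √(BB84.gBound pr.n pr.ε) * BB84.prob ρ F v ≤ t v +
      √(BB84.gBound pr.n pr.ε) *
        (if BB84.SmallSphere ρ Pt γ lam pr.ε F v then BB84.prob ρ F v else 0) := by
    intro v hv
    obtain ⟨hvV, hvP⟩ := Finset.mem_filter.mp hv
    by_cases hsm : BB84.SmallSphere ρ Pt γ lam pr.ε F v
    · rw [if_pos hsm]
      linarith [ht0 v hvV]
    · rw [if_neg hsm, mul_zero, add_zero]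
      -- For a passing view, the only way to lack the property is to exceed the threshold √g P(v).
      by_contra hlt
      exact hsm ⟨hvP, (not_le.mp hlt).le⟩
  have hsum := Finset.sum_le_sum hterm
  rw [Finset.sum_add_distrib, ← Finset.mul_sum, ← Finset.mul_sum, ← Finset.sum_filter,
    Finset.filter_filter] at hsum
  have hfilter : V.filter (fun v => BB84.Passes v ∧ BB84.SmallSphere ρ Pt γ lam pr.ε F v) =
      V.filter (BB84.SmallSphere ρ Pt γ lam pr.ε F) :=
    Finset.filter_congr fun v _ => ⟨fun h => h.2, fun h => ⟨h.1, h⟩⟩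
  rw [hfilter] at hsum
  have hsq : √(BB84.gBound pr.n pr.ε) * √(BB84.gBound pr.n pr.ε) = BB84.gBound pr.n pr.ε :=
    Real.mul_self_sqrt hg.le
  -- Since g = √g · √g, the common factor √g cancels.
  have hfin : √(BB84.gBound pr.n pr.ε) * BB84.probOf ρ V F BB84.Passes ≤
      √(BB84.gBound pr.n pr.ε) * (√(BB84.gBound pr.n pr.ε) +
        BB84.probOf ρ V F (BB84.SmallSphere ρ Pt γ lam pr.ε F)) := by
    rw [mul_add, hsq]
    simp only [BB84.probOf]
    convert hsum.trans (add_le_add_left key _) using 3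
  linarith [le_of_mul_le_mul_left hfin hg']
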